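/- Let $d\ge 2$, $R>0$, and let $\varphi:[0,\infty)\to\mathbb R$ satisfy $\int_0^\infty r^{d-1}|\varphi(r)|\,dr<\infty$ and $\varphi(r)=0$ for all $r>R_2$, where $R_2>0$. Put $R_1=\sup\{r\ge 0:\varphi(r)>0\}$, $\varphi^\pm=\max(\pm\varphi,0)$ and $C_\varphi=\int_{\mathbb R^d}\varphi(|x|)\,dx$. *Tiles and contours.* For $\delta>0$ and $i\in\mathbb Z^d$ let $T_i=[-\tfrac\delta2,\tfrac\delta2)^d+\delta i$. A configuration is a locally finite set $\omega\subset\mathbb R^d$; its spin at $i\in\mathbb Z^d$ is $\sigma(\omega,i)=0$ if $\omega\cap T_i=\emptyset$ and $\sigma(\omega,i)=1$ otherwise. For $L>0$ a site $i$ is $\sharp$-correct ($\sharp\in\{0,1\}$) if $\sigma(\omega,j)=\sharp$ for all $j\in\mathbb Z^d$ with $\delta\|i-j\|\le 2L$ (Euclidean norm), and non-correct if it is neither $0$- nor $1$-correct. A contour $\gamma$ is a finite set $\overline\gamma\subset\mathbb Z^d$ together with spins $(\sharp_i)_{i\in\overline\gamma}$ in $\{0,1\}$; a configuration $\omega$ achieves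 $\gamma$ if $\overline\gamma$ is a maximal connected component (sites at $\ell^\infty$-distance $1$ being neighbours) of the set of non-correct sites of $\omega$, and $\sharp_i=\sigma(\omega,i)$ for all $i\in\overline\gamma$. *Diluted pairwise interaction.* Let $L_R(\omega)=\bigcup_{x\in\omega}B(x,R)$ and, for $i\in\mathbb Z^d$, $$E_i(\omega)=\int_{L_R(\omega)\cap T_i}\int_{L_R(\omega)}\varphi(|x-y|)\,dy\,dx,\qquad \overline E_i(\omega)=\delta^d C_\varphi\,\mathbf 1_{\omega\cap T_i\neq\emptyset},$$ and for finite $\Lambda\subset\mathbb Z^d$ let $E_\Lambda=\sum_{i\in\Lambda}E_i$, $\overline E_\Lambda=\sum_{i\in\Lambda}\overline E_i$. **Proposition (Peierls condition for the diluted pairwise interaction).** Assume that $$C_d\int_{B(0,R)}\varphi^+(|x|)\,dx>\Big[\Big(\frac{R_1}{R}\Big)^d-1\Big]\int_{B(0,R_1)\setminus B(0,R)}\varphi^+(|x|)\,dx+\int_{\mathbb R^d}\varphi^-(|x|)\,dx,\qquad C_d=\frac{\int_0^{\pi/3}\sin^{d-2}\theta\,d\theta}{\int_0^{\pi}\sin^{d-2}\theta\,d\theta}.$$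 Then there is $\delta_0>0$ such that for all $0<\delta\le\delta_0$ and all $L>R_2+2\sqrt d\,\delta$ there is $e_+>0$ such that, for every contour $\gamma$ and every configuration $\omega$ that achieves $\gamma$, $$E_{\overline\gamma}(\omega)-\overline E_{\overline\gamma}(\omega)\ge e_+\,|\overline\gamma| .$$ -/

import Mathlib

open MeasureTheory

/-- The physical space `ℝ^d` with its Euclidean norm. -/
abbrev Space (d : ℕ) := EuclideanSpace ℝ (Fin d)

/-- The sites `ℤ^d`. -/
abbrev Site (d : ℕ) := Fin d → ℤ

/-- A site, seen as a point of `ℝ^d`. -/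
noncomputable def Site.toSpace {d : ℕ} (i : Site d) : Space d :=
  WithLp.toLp 2 (fun k => (i k : ℝ))

/-- A configuration is a locally finite set of points of `ℝ^d`. -/
def IsConfiguration {d : ℕ} (ω : Set (Space d)) : Prop :=
  ∀ B : Set (Space d), Bornology.IsBounded B → (ω ∩ B).Finite

/-- The tile `T_i = [-δ/2, δ/2)^d + δ i`. -/
def tile {d : ℕ} (δ : ℝ) (i : Site d) : Set (Space d) :=
  {x | ∀ k, x k - δ * (i k : ℝ) ∈ Set.Ico (-(δ / 2)) (δ / 2)}

/-! ### Contours -/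

open Classical in
/-- The spin `σ(ω, i)`: it is `0` if there is no point of `ω` in `T_i`, and `1` otherwise. -/
noncomputable def spin {d : ℕ} (δ : ℝ) (ω : Set (Space d)) (i : Site d) : Fin 2 :=
  if ω ∩ tile δ i = ∅ then 0 else 1

/-- The site `i` is `s`-correct: all sites within Euclidean distance `2L` (after scaling by `δ`)
have spin `s`. -/
def IsCorrect {d : ℕ} (δ L : ℝ) (ω : Set (Space d)) (s : Fin 2) (i : Site d) : Prop :=
  ∀ j : Site d, δ * ‖i.toSpace - j.toSpace‖ ≤ 2 * L → spin δ ω j = s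

/-- The set of non-correct sites. -/
def nonCorrect {d : ℕ} (δ L : ℝ) (ω : Set (Space d)) : Set (Site d) :=
  {i | ¬ ∃ s : Fin 2, IsCorrect δ L ω s i}

/-- Two distinct sites are neighbours when their `ℓ^∞`-distance is one. -/
def siteGraph (d : ℕ) : SimpleGraph (Site d) where
  Adj i j := i ≠ j ∧ ∀ k, |i k - j k| ≤ 1
  symm := ⟨fun _ _ h => ⟨h.1.symm, fun k => by rw [abs_sub_comm]; exact h.2 k⟩⟩
  loopless := ⟨fun _ h => h.1 rfl⟩

/-- `C` is a maximal connected component of the set of sites `S`. -/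
def IsComponentOf {d : ℕ} (C S : Set (Site d)) : Prop :=
  ∃ c : ((siteGraph d).induce S).ConnectedComponent, C = Subtype.val '' c.supp

/-- A support (a finite set of sites) with a spin at each of its sites. -/
structure Contour (d : ℕ) where
  support : Finset (Site d)
  spins : {i // i ∈ support} → Fin 2

/-- `ω` achieves `γ`: the support of `γ` is a maximal connected component of the set of non-correct
sites of `ω`, and the spins of `γ` are those of `ω` there. -/
def Contour.AchievedBy {d : ℕ} (γ : Contour d) (δ L : ℝ) (ω : Set (Space d)) : Prop :=
  IsComponentOf (γ.support : Set (Site d)) (nonCorrect δ L ω) ∧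
    ∀ i : {i // i ∈ γ.support}, γ.spins i = spin δ ω i.1

/-! ### The diluted pairwise interaction -/

/-- The halo `L_R(ω)`, the union of the balls of radius `R` centred at the points of `ω`. -/
def halo {d : ℕ} (R : ℝ) (ω : Set (Space d)) : Set (Space d) :=
  ⋃ x ∈ ω, Metric.closedBall x R

/-- The energy `E_i(ω)` that the diluted pairwise interaction assigns to the tile `T_i`. -/
noncomputable def tileEnergy {d : ℕ} (φ : ℝ → ℝ) (R δ : ℝ) (ω : Set (Space d)) (i : Site d) : ℝ :=
  ∫ x in halo R ω ∩ tile δ i, ∫ y in halo R ω, φ ‖x - y‖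

/-- The integral `C_φ` of the potential over `ℝ^d`. -/
noncomputable def potentialIntegral (d : ℕ) (φ : ℝ → ℝ) : ℝ :=
  ∫ x : Space d, φ ‖x‖

open Classical in
/-- The saturated energy of the tile `T_i`: it is `δ^d C_φ` if `T_i` contains a point of `ω`, and
`0` otherwise. -/
noncomputable def saturatedTileEnergy {d : ℕ} (φ : ℝ → ℝ) (δ : ℝ) (ω : Set (Space d))
    (i : Site d) : ℝ :=
  if (ω ∩ tile δ i).Nonempty then δ ^ d * potentialIntegral d φ else 0

/-- The total energy of the tiles of a finite set of sites. -/
noncomputable def energy {d : ℕ} (φ : ℝ → ℝ) (R δ : ℝ) (Λ : Finset (Site d))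
    (ω : Set (Space d)) : ℝ :=
  ∑ i ∈ Λ, tileEnergy φ R δ ω i

/-- The total saturated energy of the tiles of a finite set of sites. -/
noncomputable def saturatedEnergy {d : ℕ} (φ : ℝ → ℝ) (δ : ℝ) (Λ : Finset (Site d))
    (ω : Set (Space d)) : ℝ :=
  ∑ i ∈ Λ, saturatedTileEnergy φ δ ω i

/-- `R_1`, the supremum of the radii at which the potential is positive. -/
noncomputable def positiveRange (φ : ℝ → ℝ) : ℝ :=
  sSup {r : ℝ | 0 ≤ r ∧ 0 < φ r}

/-- The constant `C_d` (used for `d ≥ 2`). -/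
noncomputable def sectorConst (d : ℕ) : ℝ :=
  (∫ θ in (0 : ℝ)..(Real.pi / 3), Real.sin θ ^ (d - 2)) /
    (∫ θ in (0 : ℝ)..Real.pi, Real.sin θ ^ (d - 2))

/-- The integral condition on the potential; `max (φ r) 0` and `max (-φ r) 0` are the positive and
the negative part. -/
def IntegralCondition (d : ℕ) (φ : ℝ → ℝ) (R : ℝ) : Prop :=
  ((positiveRange φ / R) ^ d - 1) *
        (∫ x in Metric.closedBall (0 : Space d) (positiveRange φ) \ Metric.closedBall (0 : Space d) R,
          max (φ ‖x‖) 0) +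
      (∫ x : Space d, max (-φ ‖x‖) 0) <
    sectorConst d * ∫ x in Metric.closedBall (0 : Space d) R, max (φ ‖x‖) 0

/-! ### Consistency of the definitions -/

/-- The tile energies are translates of one another: `E_i(ω) = E_0(ω - δ i)`. -/
theorem tileEnergy_eq_translate {d : ℕ} (φ : ℝ → ℝ) (R δ : ℝ) (ω : Set (Space d)) (i : Site d) :
    tileEnergy φ R δ ω i =
      tileEnergy φ R δ ((fun x => x - δ • i.toSpace) '' ω) 0 := by
  set u : Space d := δ • i.toSpace with hu
  have hh : (fun x : Space d => x + u) ⁻¹' halo R ω = halo R ((fun x => x - u) '' ω) := by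
    ext x
    simp only [halo, Set.mem_preimage, Set.mem_iUnion, Set.mem_image, Metric.mem_closedBall,
      exists_prop, exists_exists_and_eq_and]
    refine exists_congr fun a => and_congr_right fun _ => ?_
    rw [dist_eq_norm, dist_eq_norm, show x + u - a = x - (a - u) by abel]
  have ht : (fun x : Space d => x + u) ⁻¹' tile δ i = tile δ 0 := by
    ext x
    have h : ∀ k, (x + u) k - δ * (i k : ℝ) = x k - δ * (((0 : Site d) k : ℤ) : ℝ) := by
      intro k
      simp [hu, Site.toSpace]
    exact forall_congr' fun k => by rw [h k]
  have hm : MeasurePreserving (fun x : Space d => x + u) volume volume :=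
    measurePreserving_add_right volume u
  have he : MeasurableEmbedding (fun x : Space d => x + u) := measurableEmbedding_addRight u
  unfold tileEnergy
  rw [← hm.setIntegral_preimage_emb he, Set.preimage_inter, hh, ht]
  congr 1
  funext x
  rw [← hm.setIntegral_preimage_emb he, hh]
  simp

/-- For a finite configuration the set of non-correct sites is finite, so that all the maximal
connected components of this set are supports of contours. -/
theorem nonCorrect_finite {d : ℕ} {δ : ℝ} (hδ : 0 < δ) (L : ℝ) {ω : Set (Space d)}
    (hω : ω.Finite) : (nonCorrect δ L ω).Finite := by
  obtain ⟨M, hM⟩ := hω.isBounded.exists_norm_le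
  have hfin : (Set.Icc (fun _ => -⌈(2 * L + M + δ) / δ⌉ : Site d)
      (fun _ => ⌈(2 * L + M + δ) / δ⌉)).Finite := Set.finite_Icc _ _
  refine hfin.subset fun i hi => ?_
  by_contra hc
  refine hi ⟨0, fun j hj => ?_⟩
  unfold spin
  rw [if_pos]
  by_contra hne
  obtain ⟨x, hxω, hxt⟩ := Set.nonempty_iff_ne_empty.2 hne
  apply hc
  have key : ∀ k, |(i k : ℝ)| ≤ (2 * L + M + δ) / δ := by
    intro k
    have h1 : ‖(Site.toSpace i - Site.toSpace j) k‖ ≤ ‖Site.toSpace i - Site.toSpace j‖ :=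
      PiLp.norm_apply_le _ k
    have h2 : ‖x k‖ ≤ ‖x‖ := PiLp.norm_apply_le _ k
    have h3 := hM x hxω
    have h4 := hxt k
    simp only [Site.toSpace, PiLp.sub_apply, Real.norm_eq_abs] at h1 h2
    have h5 : |δ * (j k : ℝ)| ≤ M + δ := by
      rw [Set.mem_Ico] at h4
      have := abs_le.1 (h2.trans h3)
      rw [abs_le]; constructor <;> linarith
    have h6 : δ * |(i k : ℝ) - j k| ≤ 2 * L :=
      (mul_le_mul_of_nonneg_left h1 hδ.le).trans hj
    rw [le_div_iff₀ hδ]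
    have h7 : |(i k : ℝ)| ≤ |(i k : ℝ) - j k| + |(j k : ℝ)| := by
      simpa using abs_add_le ((i k : ℝ) - j k) (j k)
    rw [abs_mul, abs_of_pos hδ] at h5
    nlinarith
  constructor <;> intro k
  · have := (abs_le.1 (key k)).1
    have h := Int.le_ceil ((2 * L + M + δ) / δ)
    have : (-(⌈(2 * L + M + δ) / δ⌉ : ℤ) : ℝ) ≤ (i k : ℝ) := by linarith
    exact_mod_cast this
  · have := (abs_le.1 (key k)).2
    have h := Int.le_ceil ((2 * L + M + δ) / δ)
    have : (i k : ℝ) ≤ ((⌈(2 * L + M + δ) / δ⌉ : ℤ) : ℝ) := by linarith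
    exact_mod_cast this

/-!
Write `H` for the halo of `ω`, `Λ` for the support of the contour, and `φ⁺`, `φ⁻` for the positive
and negative parts of the potential. If `δ` is small, the occupied tiles lie in `H`; such a tile has
its saturated energy minus its interaction with the complement of `H`, whereas the saturated energy
of an empty tile is zero. So the energy excess is at least the energy of the part `E` of `H` in the
empty tiles of `Λ` (`emptyHalo`), minus the `φ⁺`-interaction between the occupied tiles of `Λ` and
the complement of `H` (`le_energy_sub_saturatedEnergy`).

*Gain.* A point `x` of `E` lies in a ball `B` of radius `R` contained in `H`. Seen from `x`, the
ball `B` contains the part within distance `R` of a cone of half-angle `π / 3`, and such a cone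
carries the fraction `sectorConst d` of the integral of a radial function (`lintegral_radial_cone`,
by cylindrical coordinates followed by polar coordinates in the half-plane). Thus the energy density
on `E` is at least `sectorConst d * ∫_{B(0,R)} φ⁺ - ∫ φ⁻` (`le_integral_halo`).

*Loss.* A point `y` outside `H` that interacts through `φ⁺` with an occupied tile of `Λ` sees it at
distances between `R - ε` and `R₁`, where `ε` is of the order of `δ`, and it lies in a collar of
width about `R₁ - R` around `H`. So the loss is at most the volume of the collar times the integral
of `φ⁺` over a shell (`integral_occupiedTiles_le`).

*Comparison of volumes.* Join a point `y` of the collar to the nearest point `p` of `ω`. On this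
segment `p` remains the unique nearest point, so the part of it at distance between `ε` and `R` from
`p` lies in `H` and meets only empty tiles. As `y` lies in an empty tile and `p` in an occupied one,
at distance less than `2 L`, all tiles met by the segment are non-correct and belong to the same
contour (`mem_component_of_between`); so this part lies in `E`. Polar coordinates about each `p`
bound the volume of the collar by `((R₁ + ε)^d - R^d) / (R^d - ε^d)` times the volume of `E`
(`shell_mul_volume_le`, `volume_collar_le`).

As `ε` tends to `0`, the resulting inequality becomes the integral condition, which therefore holds
with room to spare for some `ε > 0` (`IntegralCondition.exists_thickening`), and the excess is at
least a positive multiple of the volume of `E`. Finally, each site of a contour is within bounded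
distance of an empty site of the contour that has an occupied neighbour, the whole tile of which
lies in `E` (`exists_card_support_le`, `card_mul_le_volume_emptyHalo`).
-/

/-! ### Radial functions and cones -/

/-- Polar coordinates for a radial function; the counterpart of `integral_fun_norm_addHaar` for the
lower Lebesgue integral. -/
theorem lintegral_fun_norm {E : Type*} [NormedAddCommGroup E] [NormedSpace ℝ E]
    [MeasurableSpace E] [BorelSpace E] [FiniteDimensional ℝ E] [Nontrivial E] (μ : Measure E)
    [μ.IsAddHaarMeasure] {f : ℝ → ENNReal} (hf : Measurable f) :
    ∫⁻ x, f ‖x‖ ∂μ = μ.toSphere Set.univ *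
      ∫⁻ r in Set.Ioi (0 : ℝ), ENNReal.ofReal (r ^ (Module.finrank ℝ E - 1)) * f r :=
  calc
    ∫⁻ x, f ‖x‖ ∂μ = ∫⁻ x : ({(0)}ᶜ : Set E), f (‖x.1‖) ∂(μ.comap (↑)) := by
      rw [lintegral_subtype_comap (measurableSet_singleton _).compl fun x ↦ f (‖x‖),
        restrict_compl_singleton]
    _ = ∫⁻ x, f x.2 ∂μ.toSphere.prod (.volumeIoiPow (Module.finrank ℝ E - 1)) := by
      simpa using μ.measurePreserving_homeomorphUnitSphereProd.lintegral_comp_emb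
        (Homeomorph.measurableEmbedding _) (f ∘ Subtype.val ∘ Prod.snd)
    _ = μ.toSphere Set.univ *
        ∫⁻ x : Set.Ioi (0 : ℝ), f x ∂.volumeIoiPow (Module.finrank ℝ E - 1) := by
      rw [lintegral_prod _ (by fun_prop)]
      simp [mul_comm]
    _ = _ := by
      rw [Measure.volumeIoiPow, lintegral_withDensity_eq_lintegral_mul _ (by fun_prop)
        (by fun_prop), ← lintegral_subtype_comap measurableSet_Ioi]
      rfl

/-- The norm pulls back null sets of `(0, ∞)` to null sets. -/
theorem ae_norm_of_ae_Ioi {E : Type*} [NormedAddCommGroup E] [NormedSpace ℝ E]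
    [MeasurableSpace E] [BorelSpace E] [FiniteDimensional ℝ E] [Nontrivial E] (μ : Measure E)
    [μ.IsAddHaarMeasure] {P : ℝ → Prop} (h : ∀ᵐ r ∂(volume.restrict (Set.Ioi (0 : ℝ))), P r) :
    ∀ᵐ x ∂μ, P ‖x‖ := by
  obtain ⟨N, hN, hNm, hN0⟩ := exists_measurable_superset_of_null (ae_iff.1 h)
  have h1 : ∫⁻ x, N.indicator 1 ‖x‖ ∂μ = 0 := by
    rw [lintegral_fun_norm μ (f := N.indicator 1) (measurable_one.indicator hNm)]
    refine mul_eq_zero_of_right _ ?_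
    rw [lintegral_eq_zero_iff' (by
      refine Measurable.aemeasurable ?_
      exact (by fun_prop : Measurable fun r : ℝ => ENNReal.ofReal (r ^ _)).mul
        (measurable_one.indicator hNm))]
    have : ∀ᵐ r ∂(volume.restrict (Set.Ioi (0 : ℝ))), r ∉ N := measure_eq_zero_iff_ae_notMem.1 hN0
    filter_upwards [this] with r hr
    simp [hr]
  rw [lintegral_eq_zero_iff (f := fun x : E => N.indicator 1 ‖x‖)
    ((measurable_one.indicator hNm).comp measurable_norm)] at h1
  filter_upwards [h1] with x hx
  by_contra hP
  have : ‖x‖ ∈ N := hN hP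
  simp [this] at hx

/-- The integral of a radial function over the cone of half-angle `α` about the first axis. -/
theorem lintegral_radial_cone {m : ℕ} (hm : 1 ≤ m) {f : ℝ → ENNReal} (hf : Measurable f) {α : ℝ}
    (hα0 : 0 ≤ α) (hα : α ≤ Real.pi) :
    ∫⁻ x in {x : Space (m + 1) | Real.cos α * ‖x‖ ≤ x 0}, f ‖x‖ =
      (volume : Measure (Space m)).toSphere Set.univ *
        ((∫⁻ r in Set.Ioi (0 : ℝ), ENNReal.ofReal (r ^ m) * f r) *
          ENNReal.ofReal (∫ θ in (0 : ℝ)..α, Real.sin θ ^ (m - 1))) := by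
  classical
  have : Nonempty (Fin m) := ⟨⟨0, hm⟩⟩
  have hnt : Nontrivial (Space m) := inferInstance
  -- the integrand in the coordinates `(t, s)`, where `s` is the distance to the axis
  set G : ℝ × ℝ → ENNReal := fun p =>
    if Real.cos α * √(p.1 ^ 2 + p.2 ^ 2) ≤ p.1 then f √(p.1 ^ 2 + p.2 ^ 2) else 0 with hG
  have hGm : Measurable G := by
    refine Measurable.ite (measurableSet_le (by fun_prop) (by fun_prop)) ?_ measurable_const
    exact hf.comp (by fun_prop)
  have hset : MeasurableSet {x : Space (m + 1) | Real.cos α * ‖x‖ ≤ x 0} :=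
    measurableSet_le (by fun_prop) (by fun_prop)
  have hcone : ∫⁻ x in {x : Space (m + 1) | Real.cos α * ‖x‖ ≤ x 0}, f ‖x‖ =
      ∫⁻ t : ℝ, ∫⁻ w : Space m, G (t, ‖w‖) := by
    rw [← lintegral_indicator hset]
    have e1 := (PiLp.volume_preserving_toLp (Fin (m + 1))).lintegral_comp_emb
      (MeasurableEquiv.toLp 2 (Fin (m + 1) → ℝ)).measurableEmbedding
      (fun x : Space (m + 1) => {x : Space (m + 1) | Real.cos α * ‖x‖ ≤ x 0}.indicator
        (fun x => f ‖x‖) x)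
    rw [← e1]
    have e2 := (volume_preserving_piFinSuccAbove
      (fun _ : Fin (m + 1) => ℝ) 0).symm.lintegral_comp_emb (MeasurableEquiv.measurableEmbedding _)
      (fun x : Fin (m + 1) → ℝ => {x : Space (m + 1) | Real.cos α * ‖x‖ ≤ x 0}.indicator
        (fun x => f ‖x‖) (WithLp.toLp 2 x))
    rw [← e2]
    have e3 : ∀ p : ℝ × (Fin m → ℝ), {x : Space (m + 1) | Real.cos α * ‖x‖ ≤ x 0}.indicator
        (fun x => f ‖x‖) (WithLp.toLp 2
          ((MeasurableEquiv.piFinSuccAbove (fun _ : Fin (m + 1) => ℝ) 0).symm p)) =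
        G (p.1, ‖(WithLp.toLp 2 p.2 : Space m)‖) := by
      rintro ⟨t, w⟩
      have hn : ‖(WithLp.toLp 2 ((MeasurableEquiv.piFinSuccAbove
          (fun _ : Fin (m + 1) => ℝ) 0).symm (t, w)) : Space (m + 1))‖ =
          √(t ^ 2 + ‖(WithLp.toLp 2 w : Space m)‖ ^ 2) := by
        rw [EuclideanSpace.norm_eq, EuclideanSpace.norm_sq_eq, Fin.sum_univ_succ]
        simp [MeasurableEquiv.piFinSuccAbove, Fin.insertNthEquiv]
      have h0 : (MeasurableEquiv.piFinSuccAbove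
          (fun _ : Fin (m + 1) => ℝ) 0).symm (t, w) 0 = t := by
        simp [MeasurableEquiv.piFinSuccAbove, Fin.insertNthEquiv]
      simp only [Set.indicator, Set.mem_ofPred_eq, hn, hG]
      rw [h0]
    simp_rw [e3]
    rw [Measure.volume_eq_prod, lintegral_prod _ (by
      refine Measurable.aemeasurable ?_
      refine hGm.comp ?_
      fun_prop)]
    refine lintegral_congr fun t => ?_
    exact (PiLp.volume_preserving_toLp (Fin m)).lintegral_comp_emb
      (MeasurableEquiv.toLp 2 (Fin m → ℝ)).measurableEmbedding (fun w => G (t, ‖w‖))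
  have hrad : ∀ t : ℝ, ∫⁻ w : Space m, G (t, ‖w‖) =
      (volume : Measure (Space m)).toSphere Set.univ *
        ∫⁻ s in Set.Ioi (0 : ℝ), ENNReal.ofReal (s ^ (m - 1)) * G (t, s) := by
    intro t
    rw [lintegral_fun_norm volume (f := fun s => G (t, s)) (hGm.comp (by fun_prop))]
    simp
  rw [hcone]
  simp_rw [hrad]
  have hm2 : Measurable fun p : ℝ × ℝ => ENNReal.ofReal (p.2 ^ (m - 1)) * G p :=
    (by fun_prop : Measurable fun p : ℝ × ℝ => ENNReal.ofReal (p.2 ^ (m - 1))).mul hGm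
  rw [lintegral_const_mul _ (by
    exact Measurable.lintegral_prod_right' (ν := volume.restrict (Set.Ioi (0 : ℝ))) hm2)]
  congr 1
  set Q : ℝ × ℝ → ENNReal := fun p => if 0 < p.2 then ENNReal.ofReal (p.2 ^ (m - 1)) * G p else 0
    with hQ
  have hQm : Measurable Q :=
    Measurable.ite (measurableSet_lt measurable_const measurable_snd) hm2 measurable_const
  have h3 : ∫⁻ t : ℝ, ∫⁻ s in Set.Ioi (0 : ℝ), ENNReal.ofReal (s ^ (m - 1)) * G (t, s) =
      ∫⁻ p : ℝ × ℝ, Q p := by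
    rw [Measure.volume_eq_prod, lintegral_prod _ hQm.aemeasurable]
    refine lintegral_congr fun t => ?_
    rw [← lintegral_indicator measurableSet_Ioi]
    rfl
  rw [h3, ← lintegral_comp_polarCoord_symm]
  -- in polar coordinates the integrand is a product
  set W : ℝ → ENNReal := (Set.Ioo 0 Real.pi ∩ Set.Iic α).indicator
    (fun θ => ENNReal.ofReal (Real.sin θ ^ (m - 1))) with hW
  have hWset : MeasurableSet (Set.Ioo 0 Real.pi ∩ Set.Iic α) :=
    measurableSet_Ioo.inter measurableSet_Iic
  have hWm : Measurable W := Measurable.indicator (by fun_prop) hWset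
  have h4 : ∫⁻ p in polarCoord.target, ENNReal.ofReal p.1 • Q (polarCoord.symm p) =
      ∫⁻ p in polarCoord.target, (ENNReal.ofReal (p.1 ^ m) * f p.1) * W p.2 := by
    refine setLIntegral_congr_fun polarCoord.open_target.measurableSet ?_
    rintro ⟨r, θ⟩ ⟨hr, hθ⟩
    have hr : 0 < r := hr
    have hsq : √((r * Real.cos θ) ^ 2 + (r * Real.sin θ) ^ 2) = r := by
      rw [show (r * Real.cos θ) ^ 2 + (r * Real.sin θ) ^ 2 = r ^ 2 by
        linear_combination r ^ 2 * Real.sin_sq_add_cos_sq θ, Real.sqrt_sq hr.le]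
    have hiff : (0 < r * Real.sin θ ∧ Real.cos α * r ≤ r * Real.cos θ) ↔
        θ ∈ Set.Ioo 0 Real.pi ∩ Set.Iic α := by
      rw [mul_comm (Real.cos α), mul_le_mul_iff_right₀ hr, mul_pos_iff_of_pos_left hr]
      constructor
      · rintro ⟨h1, h2⟩
        have hθ0 : 0 < θ := by
          by_contra h
          exact absurd h1 (not_lt.2 (Real.sin_nonpos_of_nonpos_of_neg_pi_le (not_lt.1 h) hθ.1.le))
        refine ⟨⟨hθ0, hθ.2⟩, ?_⟩
        exact (Real.strictAntiOn_cos.le_iff_ge ⟨hα0, hα⟩ ⟨hθ0.le, hθ.2.le⟩).1 h2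
      · rintro ⟨h1, h2⟩
        refine ⟨Real.sin_pos_of_mem_Ioo h1, ?_⟩
        exact (Real.strictAntiOn_cos.le_iff_ge ⟨hα0, hα⟩ ⟨h1.1.le, h1.2.le⟩).2 h2
    simp only [polarCoord_symm_apply, hQ, hG, hsq, hW, Set.indicator]
    by_cases hc : θ ∈ Set.Ioo 0 Real.pi ∩ Set.Iic α
    · obtain ⟨h1, h2⟩ := hiff.2 hc
      rw [if_pos h1, if_pos h2, if_pos hc, smul_eq_mul, mul_pow,
        ENNReal.ofReal_mul (by positivity), ← mul_assoc, ← mul_assoc,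
        ← ENNReal.ofReal_mul hr.le, ← pow_succ', Nat.sub_add_cancel hm]
      ring
    · rw [if_neg hc]
      by_cases h1 : 0 < r * Real.sin θ
      · rw [if_pos h1, if_neg (fun h2 => hc (hiff.1 ⟨h1, h2⟩))]
        simp
      · rw [if_neg h1]
        simp
  rw [h4, polarCoord_target, Measure.volume_eq_prod, ← Measure.prod_restrict,
    lintegral_prod_mul (f := fun r : ℝ => ENNReal.ofReal (r ^ m) * f r) (by fun_prop)
      hWm.aemeasurable]
  congr 1
  rw [hW, setLIntegral_indicator hWset,
    intervalIntegral.integral_of_le hα0, ofReal_integral_eq_lintegral_ofReal]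
  · refine setLIntegral_congr ?_
    have : (Set.Ioo 0 Real.pi ∩ Set.Iic α) ∩ Set.Ioo (-Real.pi) Real.pi =
        Set.Ioc 0 α ∩ Set.Iio Real.pi := by
      ext θ
      simp only [Set.mem_inter_iff, Set.mem_Ioo, Set.mem_Iic, Set.mem_Ioc, Set.mem_Iio]
      constructor
      · rintro ⟨⟨⟨a, b⟩, c⟩, -⟩
        exact ⟨⟨a, c⟩, b⟩
      · rintro ⟨⟨a, c⟩, b⟩
        exact ⟨⟨⟨a, b⟩, c⟩, by linarith [Real.pi_pos], b⟩
    rw [this]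
    have h5 : (Set.Ioc 0 α ∩ Set.Iio Real.pi : Set ℝ) =ᵐ[volume]
        (Set.Ioc 0 α ∩ Set.Iic Real.pi : Set ℝ) :=
      (Filter.EventuallyEq.refl _ _).inter Iio_ae_eq_Iic
    rwa [Set.inter_eq_left.2 (show Set.Ioc 0 α ⊆ Set.Iic Real.pi from
      fun x hx => hx.2.trans hα)] at h5
  · exact (Continuous.integrableOn_Icc (by fun_prop)).mono_set Set.Ioc_subset_Icc_self
  · filter_upwards [ae_restrict_mem measurableSet_Ioc] with θ hθ
    exact pow_nonneg (Real.sin_nonneg_of_nonneg_of_le_pi hθ.1.le (hθ.2.trans hα)) _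

/-- The cone of half-angle `π / 3` about the first axis carries the fraction `sectorConst` of the
integral of a radial function. -/
theorem lintegral_radial_sixty_cone {m : ℕ} (hm : 1 ≤ m) {f : ℝ → ENNReal} (hf : Measurable f) :
    ∫⁻ x in {x : Space (m + 1) | ‖x‖ / 2 ≤ x 0}, f ‖x‖ =
      ENNReal.ofReal (sectorConst (m + 1)) * ∫⁻ x : Space (m + 1), f ‖x‖ := by
  have h1 := lintegral_radial_cone hm hf (α := Real.pi / 3) (by positivity)
    (by linarith [Real.pi_pos])
  have h2 := lintegral_radial_cone hm hf (α := Real.pi) Real.pi_pos.le le_rfl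
  have hu : {x : Space (m + 1) | Real.cos Real.pi * ‖x‖ ≤ x 0} = Set.univ := by
    ext x
    have := (abs_le.1 (PiLp.norm_apply_le x 0)).1
    simpa using by linarith
  rw [hu, setLIntegral_univ] at h2
  have hs : {x : Space (m + 1) | Real.cos (Real.pi / 3) * ‖x‖ ≤ x 0} =
      {x : Space (m + 1) | ‖x‖ / 2 ≤ x 0} := by
    simp only [Real.cos_pi_div_three, one_div, inv_mul_eq_div]
  rw [hs] at h1
  have h0 : 0 ≤ ∫ θ in (0 : ℝ)..(Real.pi / 3), Real.sin θ ^ (m - 1) :=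
    intervalIntegral.integral_nonneg (by positivity) fun θ hθ =>
      pow_nonneg (Real.sin_nonneg_of_nonneg_of_le_pi hθ.1
        (hθ.2.trans (by linarith [Real.pi_pos]))) _
  have hpi := integral_sin_pow_pos (n := m - 1)
  have h3 : ENNReal.ofReal (∫ θ in (0 : ℝ)..(Real.pi / 3), Real.sin θ ^ (m - 1)) =
      ENNReal.ofReal (sectorConst (m + 1)) *
        ENNReal.ofReal (∫ θ in (0 : ℝ)..Real.pi, Real.sin θ ^ (m - 1)) := by
    rw [sectorConst, show m + 1 - 2 = m - 1 by omega, ← ENNReal.ofReal_mul (by positivity),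
      div_mul_cancel₀ _ hpi.ne']
  rw [h1, h2, h3]
  ring

/-- By reflection, the axis of the cone may be any unit vector `u`. -/
theorem lintegral_radial_inner_cone {m : ℕ} (hm : 1 ≤ m) {f : ℝ → ENNReal} (hf : Measurable f)
    {u : Space (m + 1)} (hu : ‖u‖ = 1) :
    ∫⁻ x in {x : Space (m + 1) | ‖x‖ / 2 ≤ inner ℝ u x}, f ‖x‖ =
      ENNReal.ofReal (sectorConst (m + 1)) * ∫⁻ x : Space (m + 1), f ‖x‖ := by
  set e : Space (m + 1) := EuclideanSpace.single 0 1 with he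
  have hen : ‖e‖ = 1 := by simp [he]
  -- the reflection that exchanges `e` and `u`
  set T := (Submodule.reflection (Submodule.span ℝ {e - u})ᗮ) with hT
  have hTe : T e = u := Submodule.reflection_sub (hen.trans hu.symm)
  rw [← lintegral_radial_sixty_cone hm hf,
    ← T.measurePreserving.setLIntegral_comp_preimage_emb T.toMeasurableEquiv.measurableEmbedding]
  have hpre : T ⁻¹' {x : Space (m + 1) | ‖x‖ / 2 ≤ inner ℝ u x} =
      {x : Space (m + 1) | ‖x‖ / 2 ≤ x 0} := by
    ext x
    simp only [Set.mem_preimage, Set.mem_ofPred_eq]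
    rw [← hTe, LinearIsometryEquiv.inner_map_map, LinearIsometryEquiv.norm_map, he,
      EuclideanSpace.inner_single_left]
    simp
  rw [hpre]
  simp

/-- A ball of radius `R` contains, as seen from any of its points, the part within distance `R` of a
cone of half-angle `π / 3`, the axis of which points to the centre. -/
theorem sixty_cone_inter_closedBall_subset {E : Type*} [NormedAddCommGroup E]
    [InnerProductSpace ℝ E] {R : ℝ} {u v : E} (huv : v = ‖v‖ • u) (hv : ‖v‖ ≤ R) :
    {x : E | ‖x‖ / 2 ≤ inner ℝ u x} ∩ Metric.closedBall 0 R ⊆ Metric.closedBall v R := by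
  rintro x ⟨hx, hxR⟩
  rw [mem_closedBall_zero_iff] at hxR
  have hx : ‖x‖ / 2 ≤ inner ℝ u x := hx
  have hR : 0 ≤ R := (norm_nonneg v).trans hv
  rw [mem_closedBall_iff_norm]
  refine abs_le_of_sq_le_sq' ?_ hR |>.2
  have h1 : inner ℝ x v = ‖v‖ * inner ℝ u x := by
    conv_lhs => rw [huv, inner_smul_right, real_inner_comm]
  rw [norm_sub_sq_real, h1]
  rcases le_total ‖x‖ ‖v‖ with h | h <;>
  nlinarith [norm_nonneg x, norm_nonneg v, mul_le_mul_of_nonneg_left hx (norm_nonneg v)]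

theorem aemeasurable_Ioi_of_integrable_fun_norm {E : Type*} [NormedAddCommGroup E]
    [NormedSpace ℝ E] [MeasurableSpace E] [BorelSpace E] [FiniteDimensional ℝ E] [Nontrivial E]
    (μ : Measure E) [μ.IsAddHaarMeasure] {f : ℝ → ℝ} (hf : Integrable (fun x => f ‖x‖) μ) :
    AEMeasurable f (volume.restrict (Set.Ioi 0)) := by
  have h := ((integrable_fun_norm_addHaar μ).1 hf).aestronglyMeasurable.aemeasurable
  have h2 : AEMeasurable (fun r : ℝ => (r ^ (Module.finrank ℝ E - 1))⁻¹ *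
      (r ^ (Module.finrank ℝ E - 1) • f r)) (volume.restrict (Set.Ioi 0)) :=
    (by fun_prop : Measurable fun r : ℝ => (r ^ (Module.finrank ℝ E - 1))⁻¹).aemeasurable.mul h
  refine h2.congr ?_
  filter_upwards [ae_restrict_mem measurableSet_Ioi] with r hr
  rw [smul_eq_mul, inv_mul_cancel_left₀ (pow_pos hr _).ne']

/-- The integral of a nonnegative radial function over a ball of radius `R` that contains the origin
is at least `sectorConst d` times its integral over the centred ball of radius `R`. -/
theorem sectorConst_mul_integral_le {d : ℕ} (hd : 2 ≤ d) {f : ℝ → ℝ} (hf0 : ∀ r, 0 ≤ f r)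
    (hf : Integrable fun x : Space d => f ‖x‖) {R : ℝ} {v : Space d} (hv : ‖v‖ ≤ R) :
    sectorConst d * ∫ x in Metric.closedBall (0 : Space d) R, f ‖x‖ ≤
      ∫ x in Metric.closedBall v R, f ‖x‖ := by
  obtain ⟨m, rfl⟩ : ∃ m, d = m + 1 := ⟨d - 1, by omega⟩
  have hm : 1 ≤ m := by omega
  -- `f` is only almost everywhere measurable: the cone formula is applied to a representative
  have hfm := aemeasurable_Ioi_of_integrable_fun_norm volume hf
  set g : ℝ → ENNReal := fun r =>
    (Set.Iic R).indicator (fun r => ENNReal.ofReal (hfm.mk f r)) r with hg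
  have hgm : Measurable g :=
    (hfm.measurable_mk.ennreal_ofReal).indicator measurableSet_Iic
  have hfg : ∀ᵐ x : Space (m + 1), f ‖x‖ = hfm.mk f ‖x‖ :=
    ae_norm_of_ae_Ioi volume hfm.ae_eq_mk
  obtain ⟨u, hu, huv⟩ : ∃ u : Space (m + 1), ‖u‖ = 1 ∧ v = ‖v‖ • u := by
    by_cases h0 : v = 0
    · exact ⟨EuclideanSpace.single 0 1, by simp, by simp [h0]⟩
    · exact ⟨‖v‖⁻¹ • v, norm_smul_inv_norm h0, by
        rw [smul_inv_smul₀ (norm_ne_zero_iff.2 h0)]⟩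
  have hgset : ∀ S : Set (Space (m + 1)), MeasurableSet S → ∫⁻ x in S, g ‖x‖ =
      ∫⁻ x in S ∩ Metric.closedBall 0 R, ENNReal.ofReal (f ‖x‖) := by
    intro S hS
    rw [Set.inter_comm, ← setLIntegral_indicator Metric.isClosed_closedBall.measurableSet]
    refine setLIntegral_congr_fun_ae hS ?_
    filter_upwards [hfg] with x hx _
    simp only [hg, Set.indicator, Set.mem_Iic, mem_closedBall_zero_iff, hx]
  have hcone := lintegral_radial_inner_cone hm hgm hu
  have hguniv := hgset _ MeasurableSet.univ
  rw [setLIntegral_univ, Set.univ_inter] at hguniv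
  rw [hgset _ (measurableSet_le (by fun_prop) (by fun_prop)), hguniv] at hcone
  have hle : ENNReal.ofReal (sectorConst (m + 1)) *
      ∫⁻ x in Metric.closedBall (0 : Space (m + 1)) R, ENNReal.ofReal (f ‖x‖) ≤
      ∫⁻ x in Metric.closedBall v R, ENNReal.ofReal (f ‖x‖) := by
    rw [← hcone]
    exact lintegral_mono_set (sixty_cone_inter_closedBall_subset huv hv)
  rw [← ofReal_integral_eq_lintegral_ofReal hf.integrableOn
      (Filter.Eventually.of_forall fun x => hf0 _),
    ← ofReal_integral_eq_lintegral_ofReal hf.integrableOn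
      (Filter.Eventually.of_forall fun x => hf0 _),
    ← ENNReal.ofReal_mul' (integral_nonneg fun x => hf0 _)] at hle
  exact (ENNReal.ofReal_le_ofReal_iff (integral_nonneg fun x => hf0 _)).1 hle


/-! ### Radial comparison of volumes and nearest-point cells -/

/-- Integration in polar coordinates. -/
theorem lintegral_eq_lintegral_sphere_Ioi {E : Type*} [NormedAddCommGroup E] [NormedSpace ℝ E]
    [MeasurableSpace E] [BorelSpace E] [FiniteDimensional ℝ E] [Nontrivial E] (μ : Measure E)
    [μ.IsAddHaarMeasure] {f : E → ENNReal} (hf : Measurable f) :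
    ∫⁻ x, f x ∂μ = ∫⁻ u : Metric.sphere (0 : E) 1, ∫⁻ r : Set.Ioi (0 : ℝ), f ((r : ℝ) • (u : E))
      ∂(Measure.volumeIoiPow (Module.finrank ℝ E - 1)) ∂μ.toSphere := by
  have h1 : ∫⁻ x, f x ∂μ = ∫⁻ x : ({(0)}ᶜ : Set E), f x ∂(μ.comap (↑)) := by
    rw [lintegral_subtype_comap (measurableSet_singleton _).compl fun x ↦ f x,
      restrict_compl_singleton]
  have h2 := μ.measurePreserving_homeomorphUnitSphereProd.lintegral_comp_emb
    (Homeomorph.measurableEmbedding _)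
    (fun p : Metric.sphere (0 : E) 1 × Set.Ioi (0 : ℝ) => f ((p.2 : ℝ) • (p.1 : E)))
  rw [lintegral_prod _ (by fun_prop)] at h2
  rw [h1, ← h2]
  refine lintegral_congr fun x => ?_
  rw [← homeomorphUnitSphereProd_symm_apply_coe, Homeomorph.symm_apply_apply]

theorem volumeIoiPow_Ico (n : ℕ) (a b : Set.Ioi (0 : ℝ)) (hab : a ≤ b) :
    Measure.volumeIoiPow n (Set.Ico a b) =
      ENNReal.ofReal (((b : ℝ) ^ (n + 1) - (a : ℝ) ^ (n + 1)) / (n + 1)) := by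
  have ha : (0 : ℝ) < a := a.2
  rw [← Set.Iio_sdiff_Iio, measure_sdiff (Set.Iio_subset_Iio hab)
    measurableSet_Iio.nullMeasurableSet (by simp [Measure.volumeIoiPow_apply_Iio]),
    Measure.volumeIoiPow_apply_Iio, Measure.volumeIoiPow_apply_Iio,
    ← ENNReal.ofReal_sub _ (by positivity), sub_div]

/-- If, on every ray that meets `A`, the set `B` contains all points at distance between `ε` and `R`
from the origin, and `A` lies in the shell between `R` and `R'`, then the volumes of `A` and `B`
compare as those of the shells. -/
theorem shell_mul_measure_le_of_radial {E : Type*} [NormedAddCommGroup E] [NormedSpace ℝ E]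
    [MeasurableSpace E] [BorelSpace E] [FiniteDimensional ℝ E] [Nontrivial E] (μ : Measure E)
    [μ.IsAddHaarMeasure] {A B : Set E} (hA : MeasurableSet A) (hB : MeasurableSet B)
    {ε R R' : ℝ} (hε : 0 < ε) (hεR : ε ≤ R) (hAR : ∀ y ∈ A, R ≤ ‖y‖ ∧ ‖y‖ < R')
    (hAB : ∀ y ∈ A, ∀ t : ℝ, 0 < t → ε ≤ ‖t • y‖ → ‖t • y‖ < R → t • y ∈ B) :
    ENNReal.ofReal (R ^ Module.finrank ℝ E - ε ^ Module.finrank ℝ E) * μ A ≤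
      ENNReal.ofReal (R' ^ Module.finrank ℝ E - R ^ Module.finrank ℝ E) * μ B := by
  rcases lt_or_ge R R' with hRR | hRR
  swap
  · have : A = ∅ := Set.eq_empty_of_forall_notMem fun y hy => by
      linarith [(hAR y hy).1, (hAR y hy).2]
    simp [this]
  set n := Module.finrank ℝ E - 1 with hn
  have hd : Module.finrank ℝ E = n + 1 := (Nat.sub_add_cancel Module.finrank_pos).symm
  set ν := Measure.volumeIoiPow n
  have hR : 0 < R := hε.trans_le hεR
  set ε' : Set.Ioi (0 : ℝ) := ⟨ε, hε⟩
  set r₀ : Set.Ioi (0 : ℝ) := ⟨R, hR⟩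
  set r₁ : Set.Ioi (0 : ℝ) := ⟨R', hR.trans hRR⟩
  have hn1 : (0 : ℝ) < n + 1 := by positivity
  have key : ν (Set.Ico ε' r₀) * μ A ≤ ν (Set.Ico r₀ r₁) * μ B := by
    rw [← lintegral_indicator_one hA, ← lintegral_indicator_one hB,
      lintegral_eq_lintegral_sphere_Ioi μ (measurable_one.indicator hA),
      lintegral_eq_lintegral_sphere_Ioi μ (measurable_one.indicator hB),
      ← lintegral_const_mul' _ _ (by
        rw [volumeIoiPow_Ico _ _ _ (show ε' ≤ r₀ from hεR)]; exact ENNReal.ofReal_ne_top),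
      ← lintegral_const_mul' _ _ (by
        rw [volumeIoiPow_Ico _ _ _ (show r₀ ≤ r₁ from hRR.le)]; exact ENNReal.ofReal_ne_top)]
    refine lintegral_mono fun u => ?_
    have hu : ‖(u : E)‖ = 1 := by simp
    have hnorm : ∀ r : Set.Ioi (0 : ℝ), ‖(r : ℝ) • (u : E)‖ = r := fun r => by
      rw [norm_smul, hu, mul_one, Real.norm_of_nonneg (le_of_lt r.2)]
    have hmeas : Measurable fun r : Set.Ioi (0 : ℝ) => (r : ℝ) • (u : E) := by fun_prop
    have hind : ∀ S : Set E, MeasurableSet S →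
        (∫⁻ r : Set.Ioi (0 : ℝ), S.indicator 1 ((r : ℝ) • (u : E)) ∂ν) =
          ν ((fun r : Set.Ioi (0 : ℝ) => (r : ℝ) • (u : E)) ⁻¹' S) :=
      fun S hS => lintegral_indicator_one (hmeas hS)
    simp only [← hn]
    rw [hind A hA, hind B hB]
    by_cases hne : ∃ r : Set.Ioi (0 : ℝ), (r : ℝ) • (u : E) ∈ A
    · obtain ⟨r, hr⟩ := hne
      have h1 : (fun r : Set.Ioi (0 : ℝ) => (r : ℝ) • (u : E)) ⁻¹' A ⊆ Set.Ico r₀ r₁ := by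
        intro s hs
        have := hAR _ hs
        rw [hnorm] at this
        exact this
      have h2 : Set.Ico ε' r₀ ⊆ (fun r : Set.Ioi (0 : ℝ) => (r : ℝ) • (u : E)) ⁻¹' B := by
        intro s hs
        have hs0 : (0 : ℝ) < s := s.2
        have hr0 : (0 : ℝ) < r := r.2
        have hsm : ((s : ℝ) / r) • (r : ℝ) • (u : E) = (s : ℝ) • (u : E) := by
          rw [smul_smul, div_mul_cancel₀ _ hr0.ne']
        have := hAB _ hr ((s : ℝ) / r) (by positivity)
        rw [hsm, hnorm] at this
        exact this hs.1 hs.2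
      calc _ ≤ ν (Set.Ico ε' r₀) * ν (Set.Ico r₀ r₁) := by gcongr
        _ = ν (Set.Ico r₀ r₁) * ν (Set.Ico ε' r₀) := mul_comm _ _
        _ ≤ _ := by gcongr
    · have : (fun r : Set.Ioi (0 : ℝ) => (r : ℝ) • (u : E)) ⁻¹' A = ∅ :=
        Set.eq_empty_of_forall_notMem fun r hr => hne ⟨r, hr⟩
      simp [this]
  rw [volumeIoiPow_Ico _ _ _ (show ε' ≤ r₀ from hεR),
    volumeIoiPow_Ico _ _ _ (show r₀ ≤ r₁ from hRR.le), div_eq_inv_mul, div_eq_inv_mul,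
    ENNReal.ofReal_mul (by positivity), ENNReal.ofReal_mul (by positivity), mul_assoc,
    mul_assoc] at key
  rw [hd]
  exact (ENNReal.mul_le_mul_iff_right (ENNReal.ofReal_pos.2 (by positivity)).ne'
    ENNReal.ofReal_ne_top).1 key

theorem IsConfiguration.countable {d : ℕ} {ω : Set (Space d)} (hω : IsConfiguration ω) :
    ω.Countable := by
  have : ω = ⋃ n : ℕ, ω ∩ Metric.closedBall 0 n := by
    rw [← Set.inter_iUnion, Metric.iUnion_closedBall_nat, Set.inter_univ]
  rw [this]
  exact Set.countable_iUnion fun n => (hω _ Metric.isBounded_closedBall).countable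

theorem IsConfiguration.exists_nearest {d : ℕ} {ω : Set (Space d)} (hω : IsConfiguration ω)
    (hne : ω.Nonempty) (y : Space d) : ∃ p ∈ ω, ∀ q ∈ ω, dist y p ≤ dist y q := by
  obtain ⟨p₀, hp₀⟩ := hne
  obtain ⟨p, hp, hmin⟩ := Set.exists_min_image _ (fun q => dist y q)
    (hω (Metric.closedBall y (dist y p₀)) Metric.isBounded_closedBall)
    ⟨p₀, hp₀, by simp [dist_comm]⟩
  refine ⟨p, hp.1, fun q hq => ?_⟩
  by_cases h : dist y q ≤ dist y p₀
  · exact hmin q ⟨hq, by rwa [Metric.mem_closedBall, dist_comm]⟩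
  · exact (hmin p₀ ⟨hp₀, by simp [dist_comm]⟩).trans (not_le.1 h).le

/-- If `p` is at most as far from `y` as `q`, then it is strictly nearer than `q` to every point of
the segment from `p` to `y` other than `y`. -/
theorem dist_add_smul_lt {E : Type*} [NormedAddCommGroup E] [InnerProductSpace ℝ E] {p q y : E}
    (hpq : q ≠ p) (h : dist y p ≤ dist y q) {t : ℝ} (ht0 : 0 ≤ t) (ht1 : t < 1) :
    dist (p + t • (y - p)) p < dist (p + t • (y - p)) q := by
  have h1 : 0 < ‖q - p‖ := norm_pos_iff.2 (sub_ne_zero.2 hpq)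
  rw [dist_eq_norm, dist_eq_norm] at *
  rw [show p + t • (y - p) - p = t • (y - p) by abel,
    show p + t • (y - p) - q = t • (y - p) - (q - p) by abel]
  rw [show y - q = (y - p) - (q - p) by abel] at h
  have h2 := pow_le_pow_left₀ (norm_nonneg _) h 2
  rw [norm_sub_sq_real (y - p) (q - p)] at h2
  refine lt_of_pow_lt_pow_left₀ 2 (norm_nonneg _) ?_
  rw [norm_sub_sq_real (t • (y - p)) (q - p), inner_smul_left]
  simp only [conj_trivial]
  nlinarith [pow_pos h1 2]

/-- `shell_mul_measure_le_of_radial`, summed over the nearest-point cells of a configuration `ω`: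
`A` is a set of points at distance between `R` and `R'` from `ω`; `B` contains all points that lie
on a segment from a point of `A` to its nearest point `p` in `ω`, at distance between `ε` and `R`
from `p`. -/
theorem shell_mul_volume_le {d : ℕ} (hd : 1 ≤ d) {ω : Set (Space d)} (hω : IsConfiguration ω)
    {A B : Set (Space d)} (hA : MeasurableSet A) (hB : MeasurableSet B) {ε R R' : ℝ}
    (hε : 0 < ε) (hεR : ε ≤ R) (hAR : ∀ y ∈ A, ∀ p ∈ ω, (∀ q ∈ ω, dist y p ≤ dist y q) →
      R ≤ dist y p ∧ dist y p < R') (hne : A.Nonempty → ω.Nonempty)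
    (hAB : ∀ y ∈ A, ∀ p ∈ ω, (∀ q ∈ ω, dist y p ≤ dist y q) → ∀ t : ℝ, 0 < t → t < 1 →
      ε ≤ ‖t • (y - p)‖ → ‖t • (y - p)‖ < R →
      (∀ q ∈ ω, q ≠ p → dist (p + t • (y - p)) p < dist (p + t • (y - p)) q) →
        p + t • (y - p) ∈ B) :
    ENNReal.ofReal (R ^ d - ε ^ d) * volume A ≤ ENNReal.ofReal (R' ^ d - R ^ d) * volume B := by
  have : Nonempty (Fin d) := ⟨⟨0, hd⟩⟩
  have hnt : Nontrivial (Space d) := inferInstance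
  have hc := hω.countable
  have := hc.to_subtype
  -- the cells of `A` may overlap, those of `B` are disjoint as nearest points are unique there
  set a : ω → Set (Space d) := fun p => A ∩ {y | ∀ q ∈ ω, dist y p ≤ dist y q} with ha
  set b : ω → Set (Space d) := fun p => B ∩ {y | ∀ q ∈ ω, q ≠ p → dist y p < dist y q} with hb
  have ham : ∀ p, MeasurableSet (a p) := fun p => by
    refine hA.inter ?_
    simp only [Set.ofPred_forall]
    exact MeasurableSet.biInter hc fun q _ => measurableSet_le (by fun_prop) (by fun_prop)
  have hbm : ∀ p, MeasurableSet (b p) := fun p => by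
    refine hB.inter ?_
    simp only [Set.ofPred_forall]
    refine MeasurableSet.biInter hc fun q _ => MeasurableSet.iInter fun _ =>
      measurableSet_lt (by fun_prop) (by fun_prop)
  have hcov : A ⊆ ⋃ p, a p := fun y hy => by
    obtain ⟨p, hp, hmin⟩ := hω.exists_nearest (hne ⟨y, hy⟩) y
    exact Set.mem_iUnion.2 ⟨⟨p, hp⟩, hy, hmin⟩
  have hdisj : Pairwise (Function.onFun Disjoint b) := by
    intro p q hpq
    refine Set.disjoint_left.2 fun y hyp hyq => ?_
    exact lt_asymm (hyp.2 q q.2 fun h => hpq (Subtype.ext h.symm))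
      (hyq.2 p p.2 fun h => hpq (Subtype.ext h))
  have hcell : ∀ p, ENNReal.ofReal (R ^ d - ε ^ d) * volume (a p) ≤
      ENNReal.ofReal (R' ^ d - R ^ d) * volume (b p) := by
    intro p
    have h := shell_mul_measure_le_of_radial (volume : Measure (Space d))
      (A := (fun x => x + (p : Space d)) ⁻¹' a p) (B := (fun x => x + (p : Space d)) ⁻¹' b p)
      (R' := R') ((measurable_add_const _) (ham p)) ((measurable_add_const _) (hbm p)) hε hεR ?_ ?_
    · rwa [measure_preimage_add_right, measure_preimage_add_right, finrank_euclideanSpace_fin] at h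
    · intro y hy
      have := hAR _ hy.1 p p.2 hy.2
      rwa [dist_eq_norm, add_sub_cancel_right] at this
    · intro y hy t ht h1 h2
      have h3 := hAR _ hy.1 p p.2 hy.2
      rw [dist_eq_norm, add_sub_cancel_right] at h3
      have ht1 : t < 1 := by
        by_contra hcon
        rw [norm_smul, Real.norm_of_nonneg ht.le] at h2
        nlinarith [norm_nonneg y, not_lt.1 hcon]
      have hlt : ∀ q ∈ ω, q ≠ (p : Space d) →
          dist ((p : Space d) + t • (y + p - p)) p < dist ((p : Space d) + t • (y + p - p)) q :=
        fun q hq hqp => dist_add_smul_lt hqp (hy.2 q hq) ht.le ht1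
      have h4 := hAB _ hy.1 p p.2 hy.2 t ht ht1 (by rwa [add_sub_cancel_right])
        (by rwa [add_sub_cancel_right]) hlt
      rw [add_sub_cancel_right] at h4 hlt
      rw [add_comm] at h4
      rw [Set.mem_preimage]
      refine ⟨h4, fun q hq hqp => ?_⟩
      have := hlt q hq hqp
      rwa [add_comm (p : Space d)] at this
  calc ENNReal.ofReal (R ^ d - ε ^ d) * volume A
      ≤ ENNReal.ofReal (R ^ d - ε ^ d) * ∑' p, volume (a p) := by
        gcongr
        exact (measure_mono hcov).trans (measure_iUnion_le _)
    _ = ∑' p, ENNReal.ofReal (R ^ d - ε ^ d) * volume (a p) := ENNReal.tsum_mul_left.symm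
    _ ≤ ∑' p, ENNReal.ofReal (R' ^ d - R ^ d) * volume (b p) := ENNReal.tsum_le_tsum hcell
    _ = ENNReal.ofReal (R' ^ d - R ^ d) * volume (⋃ p, b p) := by
        rw [ENNReal.tsum_mul_left, measure_iUnion hdisj hbm]
    _ ≤ _ := by
        gcongr
        exact Set.iUnion_subset fun p => Set.inter_subset_left


/-! ### Sites, tiles and contours -/

/-- The coordinates of `k` lie between those of `i` and those of `j`. -/
def Site.Between {d : ℕ} (i k j : Site d) : Prop :=
  ∀ l, (i l ≤ k l ∧ k l ≤ j l) ∨ (j l ≤ k l ∧ k l ≤ i l)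

theorem Site.Between.symm {d : ℕ} {i k j : Site d} (h : Site.Between i k j) :
    Site.Between j k i := fun l => (h l).symm

theorem Site.Between.right {d : ℕ} (i j : Site d) : Site.Between i j j := fun l => by omega

theorem norm_toSpace_sub_le {d : ℕ} {i j i' j' : Site d} (h : ∀ l, |i l - j l| ≤ |i' l - j' l|) :
    ‖i.toSpace - j.toSpace‖ ≤ ‖i'.toSpace - j'.toSpace‖ := by
  rw [EuclideanSpace.norm_eq, EuclideanSpace.norm_eq]
  refine Real.sqrt_le_sqrt (Finset.sum_le_sum fun l _ => ?_)
  refine pow_le_pow_left₀ (norm_nonneg _) ?_ 2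
  have := h l
  simp only [Site.toSpace, PiLp.sub_apply, Real.norm_eq_abs]
  exact_mod_cast this

theorem Site.Between.norm_sub_le {d : ℕ} {i k j : Site d} (h : Site.Between i k j) :
    ‖i.toSpace - k.toSpace‖ ≤ ‖i.toSpace - j.toSpace‖ := by
  refine norm_toSpace_sub_le fun l => ?_
  rcases h l with h | h <;> [rw [abs_of_nonpos (by omega), abs_of_nonpos (by omega)];
    rw [abs_of_nonneg (by omega), abs_of_nonneg (by omega)]] <;> omega

/-- One step from `k` towards `i` inside the box spanned by `i` and `j`. -/
theorem Site.Between.exists_step {d : ℕ} {i k j : Site d} (h : Site.Between i k j) (hki : k ≠ i) :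
    ∃ k', Site.Between i k' j ∧ (siteGraph d).Adj k' k ∧
      ∑ l, (k' l - i l).natAbs < ∑ l, (k l - i l).natAbs := by
  obtain ⟨l₀, hl₀⟩ := Function.ne_iff.1 hki
  refine ⟨fun l => if i l < k l then k l - 1 else if k l < i l then k l + 1 else k l,
    fun l => ?_, ⟨?_, fun l => ?_⟩, ?_⟩
  · have := h l
    beta_reduce
    split_ifs <;> omega
  · intro heq
    have := congrFun heq l₀
    split_ifs at this <;> omega
  · beta_reduce
    rw [abs_le]
    split_ifs <;> omega
  · refine Finset.sum_lt_sum (fun l _ => ?_) ⟨l₀, Finset.mem_univ _, ?_⟩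
    · beta_reduce
      split_ifs <;> omega
    · beta_reduce
      split_ifs <;> omega

/-- Induction along a path of neighbouring sites from `i` to `k` inside the box spanned by `i`
and `j`. -/
theorem Site.Between.induction {d : ℕ} {i j : Site d} {P : Site d → Prop} (hi : P i)
    (hstep : ∀ k k', Site.Between i k j → Site.Between i k' j → (siteGraph d).Adj k' k →
      P k' → P k) {k : Site d} (hk : Site.Between i k j) : P k := by
  induction hn : ∑ l, (k l - i l).natAbs using Nat.strong_induction_on generalizing k with
  | _ n ih =>
    by_cases hki : k = i
    · rwa [hki]
    · obtain ⟨k', hk', hadj, hlt⟩ := hk.exists_step hki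
      exact hstep k k' hk hk' hadj (ih _ (hn ▸ hlt) hk' rfl)

theorem mem_of_isComponentOf_of_adj {d : ℕ} {C S : Set (Site d)} (h : IsComponentOf C S)
    {i j : Site d} (hi : i ∈ C) (hj : j ∈ S) (hij : (siteGraph d).Adj i j) : j ∈ C := by
  obtain ⟨c, rfl⟩ := h
  obtain ⟨i, hic, rfl⟩ := hi
  refine ⟨⟨j, hj⟩, ?_, rfl⟩
  rw [SimpleGraph.ConnectedComponent.mem_supp_iff] at hic ⊢
  rw [← hic]
  have hadj : ((siteGraph d).induce S).Adj ⟨j, hj⟩ i := hij.symm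
  exact SimpleGraph.ConnectedComponent.sound hadj.reachable

theorem subset_of_isComponentOf {d : ℕ} {C S : Set (Site d)} (h : IsComponentOf C S) : C ⊆ S := by
  obtain ⟨c, rfl⟩ := h
  rintro _ ⟨i, -, rfl⟩
  exact i.2

theorem mem_nonCorrect_of_spin_ne {d : ℕ} {δ L : ℝ} {ω : Set (Space d)} {i j k : Site d}
    (hs : spin δ ω i ≠ spin δ ω j) (hi : δ * ‖k.toSpace - i.toSpace‖ ≤ 2 * L)
    (hj : δ * ‖k.toSpace - j.toSpace‖ ≤ 2 * L) : k ∈ nonCorrect δ L ω := by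
  rintro ⟨s, hc⟩
  exact hs ((hc i hi).trans (hc j hj).symm)

/-- All sites of the box spanned by two sites with different spins, not more than `2 L` apart, are
non-correct, and hence belong to the same contour. -/
theorem mem_component_of_between {d : ℕ} {δ L : ℝ} (hδ : 0 ≤ δ) {ω : Set (Space d)}
    {C : Set (Site d)} (hC : IsComponentOf C (nonCorrect δ L ω)) {i j k : Site d} (hi : i ∈ C)
    (hs : spin δ ω i ≠ spin δ ω j) (hij : δ * ‖i.toSpace - j.toSpace‖ ≤ 2 * L)
    (hk : Site.Between i k j) : k ∈ C := by
  refine Site.Between.induction (P := fun k => k ∈ C) hi (fun k k' hk hk' hadj hkC => ?_) hk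
  refine mem_of_isComponentOf_of_adj hC hkC (mem_nonCorrect_of_spin_ne hs ?_ ?_) hadj
  · rw [norm_sub_rev]
    exact (mul_le_mul_of_nonneg_left hk.norm_sub_le hδ).trans hij
  · rw [norm_sub_rev]
    refine (mul_le_mul_of_nonneg_left hk.symm.norm_sub_le hδ).trans ?_
    rwa [norm_sub_rev]

theorem exists_adj_spin_ne {d : ℕ} {δ : ℝ} {ω : Set (Space d)} {i j : Site d}
    (hs : spin δ ω i ≠ spin δ ω j) : ∃ k k', Site.Between i k j ∧ Site.Between i k' j ∧
      (siteGraph d).Adj k' k ∧ spin δ ω k ≠ spin δ ω k' := by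
  by_contra! hcon
  refine hs (Eq.symm ?_)
  refine Site.Between.induction (P := fun k => spin δ ω k = spin δ ω i) rfl ?_
    (Site.Between.right i j)
  intro k k' hk hk' hadj h
  exact (hcon k k' hk hk' hadj).trans h

theorem spin_eq_one_iff {d : ℕ} {δ : ℝ} {ω : Set (Space d)} {i : Site d} :
    spin δ ω i = 1 ↔ (ω ∩ tile δ i).Nonempty := by
  unfold spin
  split_ifs with h
  · simp [h]
  · simpa using Set.nonempty_iff_ne_empty.2 h

theorem spin_eq_zero_iff {d : ℕ} {δ : ℝ} {ω : Set (Space d)} {i : Site d} :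
    spin δ ω i = 0 ↔ ω ∩ tile δ i = ∅ := by
  unfold spin
  split_ifs with h
  · simp [h]
  · simpa using h

/-- The site of the tile that contains `x`. -/
noncomputable def siteOf {d : ℕ} (δ : ℝ) (x : Space d) : Site d := fun l => ⌊x l / δ + 1 / 2⌋

theorem mem_tile_iff {d : ℕ} {δ : ℝ} (hδ : 0 < δ) {x : Space d} {i : Site d} :
    x ∈ tile δ i ↔ siteOf δ x = i := by
  rw [funext_iff]
  refine forall_congr' fun l => ?_
  simp only [siteOf, Int.floor_eq_iff, Set.mem_Ico]
  have hx : x l = δ * (x l / δ) := by field_simp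
  set y := x l / δ
  rw [hx]
  constructor
  · rintro ⟨h1, h2⟩
    constructor <;> nlinarith
  · rintro ⟨h1, h2⟩
    constructor <;> nlinarith

theorem mem_tile_siteOf {d : ℕ} {δ : ℝ} (hδ : 0 < δ) (x : Space d) : x ∈ tile δ (siteOf δ x) :=
  (mem_tile_iff hδ).2 rfl

/-- The sites of the tiles met by a segment lie in the box spanned by the sites of its ends, as each
coordinate of the site is monotone in the coordinate of the point. -/
theorem siteOf_between {d : ℕ} {δ : ℝ} (hδ : 0 < δ) (p y : Space d) {t : ℝ} (ht0 : 0 ≤ t)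
    (ht1 : t ≤ 1) : Site.Between (siteOf δ p) (siteOf δ (p + t • (y - p))) (siteOf δ y) := by
  intro l
  have hmono : ∀ a b : ℝ, a ≤ b → ⌊a / δ + 1 / 2⌋ ≤ ⌊b / δ + 1 / 2⌋ := fun a b h => by gcongr
  simp only [siteOf, PiLp.add_apply, PiLp.smul_apply, PiLp.sub_apply, smul_eq_mul]
  rcases le_total (p l) (y l) with h | h
  · exact Or.inl ⟨hmono _ _ (by nlinarith), hmono _ _ (by nlinarith)⟩
  · exact Or.inr ⟨hmono _ _ (by nlinarith), hmono _ _ (by nlinarith)⟩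

theorem norm_le_sqrt_mul_of_forall_abs_le {d : ℕ} {x : Space d} {c : ℝ} (hc : 0 ≤ c)
    (h : ∀ l, |x l| ≤ c) : ‖x‖ ≤ √(d : ℝ) * c := by
  rw [EuclideanSpace.norm_eq, ← Real.sqrt_sq hc, ← Real.sqrt_mul (Nat.cast_nonneg d)]
  refine Real.sqrt_le_sqrt ?_
  calc ∑ l, ‖x l‖ ^ 2 ≤ ∑ _l : Fin d, c ^ 2 := Finset.sum_le_sum fun l _ =>
        pow_le_pow_left₀ (norm_nonneg _) (h l) 2
    _ = d * c ^ 2 := by simp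

theorem dist_le_of_mem_tile {d : ℕ} {δ : ℝ} (hδ : 0 < δ) {x y : Space d} {i : Site d}
    (hx : x ∈ tile δ i) (hy : y ∈ tile δ i) : dist x y ≤ √(d : ℝ) * δ := by
  rw [dist_eq_norm]
  refine norm_le_sqrt_mul_of_forall_abs_le hδ.le fun l => ?_
  have h1 := hx l
  have h2 := hy l
  rw [Set.mem_Ico] at h1 h2
  rw [PiLp.sub_apply, abs_le]
  constructor <;> linarith

theorem dist_le_of_mem_tile_of_adj {d : ℕ} {δ : ℝ} (hδ : 0 < δ) {x y : Space d} {i j : Site d}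
    (hij : (siteGraph d).Adj i j) (hx : x ∈ tile δ i) (hy : y ∈ tile δ j) :
    dist x y ≤ 2 * (√(d : ℝ) * δ) := by
  rw [dist_eq_norm, mul_left_comm]
  refine norm_le_sqrt_mul_of_forall_abs_le (by positivity) fun l => ?_
  have h1 := hx l
  have h2 := hy l
  have h3 := abs_le.1 (hij.2 l)
  have h4 : (-1 : ℝ) ≤ i l - j l := by exact_mod_cast h3.1
  have h5 : (i l - j l : ℝ) ≤ 1 := by exact_mod_cast h3.2
  rw [Set.mem_Ico] at h1 h2
  rw [PiLp.sub_apply, abs_le]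
  constructor <;> nlinarith

theorem dist_smul_toSpace_le_of_mem_tile {d : ℕ} {δ : ℝ} (hδ : 0 < δ) {x : Space d} {i : Site d}
    (hx : x ∈ tile δ i) : dist x (δ • i.toSpace) ≤ √(d : ℝ) * (δ / 2) := by
  rw [dist_eq_norm]
  refine norm_le_sqrt_mul_of_forall_abs_le (by positivity) fun l => ?_
  have h1 := hx l
  rw [Set.mem_Ico] at h1
  simp only [PiLp.sub_apply, PiLp.smul_apply, Site.toSpace, smul_eq_mul]
  rw [abs_le]
  constructor <;> linarith

theorem mul_norm_siteOf_sub_le {d : ℕ} {δ : ℝ} (hδ : 0 < δ) (x y : Space d) :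
    δ * ‖(siteOf δ x).toSpace - (siteOf δ y).toSpace‖ ≤ dist x y + √(d : ℝ) * δ := by
  have h1 := dist_smul_toSpace_le_of_mem_tile hδ (mem_tile_siteOf hδ x)
  have h2 := dist_smul_toSpace_le_of_mem_tile hδ (mem_tile_siteOf hδ y)
  have h3 : δ * ‖(siteOf δ x).toSpace - (siteOf δ y).toSpace‖ =
      dist (δ • (siteOf δ x).toSpace) (δ • (siteOf δ y).toSpace) := by
    rw [dist_eq_norm, ← smul_sub, norm_smul, Real.norm_of_nonneg hδ.le]
  rw [h3]
  have h4 := dist_triangle4 (δ • (siteOf δ x).toSpace) x y (δ • (siteOf δ y).toSpace)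
  rw [dist_comm _ x] at h4
  linarith

theorem measurableSet_tile {d : ℕ} (δ : ℝ) (i : Site d) : MeasurableSet (tile δ i) := by
  simp only [tile, Set.ofPred_forall]
  exact MeasurableSet.iInter fun l => measurableSet_Ico.preimage (by fun_prop)

theorem volume_tile {d : ℕ} {δ : ℝ} (hδ : 0 < δ) (i : Site d) :
    volume (tile δ i) = ENNReal.ofReal (δ ^ d) := by
  have h : (WithLp.toLp 2 : (Fin d → ℝ) → Space d) ⁻¹' tile δ i =
      Set.univ.pi fun l => Set.Ico (δ * i l - δ / 2) (δ * i l + δ / 2) := by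
    ext x
    simp only [tile, Set.mem_preimage, Set.mem_ofPred_eq, Set.mem_pi, Set.mem_univ, true_imp_iff,
      Set.mem_Ico]
    refine forall_congr' fun l => ?_
    constructor <;> rintro ⟨h1, h2⟩ <;> constructor <;> linarith
  rw [← (PiLp.volume_preserving_toLp (Fin d)).measure_preimage
    (measurableSet_tile δ i).nullMeasurableSet, h, volume_pi_pi]
  simp only [Real.volume_Ico]
  have h1 : ∀ l, δ * (i l : ℝ) + δ / 2 - (δ * i l - δ / 2) = δ := fun l => by ring
  simp only [h1, Finset.prod_const, Finset.card_univ, Fintype.card_fin, ENNReal.ofReal_pow hδ.le]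

theorem disjoint_tile {d : ℕ} {δ : ℝ} (hδ : 0 < δ) {i j : Site d} (hij : i ≠ j) :
    Disjoint (tile δ i) (tile δ j) :=
  Set.disjoint_left.2 fun _ hi hj =>
    hij (((mem_tile_iff hδ).1 hi).symm.trans ((mem_tile_iff hδ).1 hj))

theorem finite_sites_norm_le {d : ℕ} (r : ℝ) : {i : Site d | ‖Site.toSpace i‖ ≤ r}.Finite := by
  refine (Set.finite_Icc (fun _ => -⌈r⌉ : Site d) (fun _ => ⌈r⌉)).subset fun i hi => ?_
  have key : ∀ l, |i l| ≤ ⌈r⌉ := fun l => by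
    have h1 : ‖Site.toSpace i l‖ ≤ ‖Site.toSpace i‖ := PiLp.norm_apply_le _ l
    have h2 : |(i l : ℝ)| ≤ (⌈r⌉ : ℝ) := (h1.trans hi).trans (Int.le_ceil r)
    exact_mod_cast h2
  exact ⟨fun l => (abs_le.1 (key l)).1, fun l => (abs_le.1 (key l)).2⟩

/-- The number of sites of a contour is bounded by a multiple of the number of its empty sites that
have an occupied neighbour. -/
theorem exists_card_support_le {d : ℕ} {δ L : ℝ} (hδ : 0 < δ) (hL : √(d : ℝ) * δ ≤ 2 * L) :
    ∃ N : ℕ, 0 < N ∧ ∀ (γ : Contour d) (ω : Set (Space d)), γ.AchievedBy δ L ω →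
      ∀ K : Finset (Site d), (∀ k ∈ γ.support, spin δ ω k = 0 →
        (∃ k', (siteGraph d).Adj k k' ∧ spin δ ω k' = 1) → k ∈ K) →
        γ.support.card ≤ N * K.card := by
  classical
  have hfin := finite_sites_norm_le (d := d) (2 * L / δ)
  have h0 : (0 : Site d) ∈ hfin.toFinset := by
    have h2 : 0 ≤ 2 * L := le_trans (by positivity) hL
    have h3 : (0 : Site d).toSpace = 0 := by ext l; simp [Site.toSpace]
    simp only [Set.Finite.mem_toFinset, Set.mem_ofPred_eq, h3, norm_zero]
    positivity
  refine ⟨hfin.toFinset.card, Finset.card_pos.2 ⟨0, h0⟩, fun γ ω hγ K hK => ?_⟩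
  have hC := hγ.1
  have hcov : γ.support ⊆ Finset.image (fun p : Site d × Site d => p.1 + p.2)
      (hfin.toFinset ×ˢ K) := by
    intro i hi
    have hinc := subset_of_isComponentOf hC hi
    -- a site within distance `2 L` whose spin differs from that of `i`
    obtain ⟨j, hj, hsj⟩ : ∃ j : Site d, δ * ‖i.toSpace - j.toSpace‖ ≤ 2 * L ∧
        spin δ ω i ≠ spin δ ω j := by
      by_contra! hcon
      exact hinc ⟨spin δ ω i, fun j hj => (hcon j hj).symm⟩
    obtain ⟨k, k', hk, hk', hadj, hs⟩ := exists_adj_spin_ne hsj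
    have hmem : ∀ k, Site.Between i k j → k ∈ γ.support := fun k hk =>
      mem_component_of_between hδ.le hC hi hsj hj hk
    have key : ∀ k k', Site.Between i k j → (siteGraph d).Adj k k' → spin δ ω k = 0 →
        spin δ ω k' = 1 → i ∈ Finset.image (fun p : Site d × Site d => p.1 + p.2)
          (hfin.toFinset ×ˢ K) := by
      intro k k' hk hadj h0 h1
      refine Finset.mem_image.2 ⟨(i - k, k), Finset.mem_product.2 ⟨?_, ?_⟩, sub_add_cancel i k⟩
      · have h2 := (mul_le_mul_of_nonneg_left hk.norm_sub_le hδ.le).trans hj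
        have h3 : (i - k).toSpace = i.toSpace - k.toSpace := by ext l; simp [Site.toSpace]
        simp only [Set.Finite.mem_toFinset, Set.mem_ofPred_eq, h3]
        rw [le_div_iff₀ hδ, mul_comm]
        exact h2
      · exact hK k (hmem k hk) h0 ⟨k', hadj, h1⟩
    have hfin2 : ∀ s : Fin 2, s = 0 ∨ s = 1 := by decide
    rcases hfin2 (spin δ ω k) with h | h
    · exact key k k' hk hadj.symm h ((hfin2 _).resolve_left fun h' => hs (h.trans h'.symm))
    · exact key k' k hk' hadj ((hfin2 _).resolve_right fun h' => hs (h.trans h'.symm)) h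
  calc γ.support.card ≤ _ := Finset.card_le_card hcov
    _ ≤ (hfin.toFinset ×ˢ K).card := Finset.card_image_le
    _ = _ := Finset.card_product _ _


/-! ### The strict inequality with room to spare -/

theorem le_of_pos_of_forall_eq_zero {φ : ℝ → ℝ} {R₂ : ℝ} (hsupp : ∀ r, R₂ < r → φ r = 0) {r : ℝ}
    (h : 0 < φ r) : r ≤ R₂ := by
  by_contra hr
  exact h.ne' (hsupp r (not_le.1 hr))

theorem positiveRange_le {φ : ℝ → ℝ} {R₂ : ℝ} (hR₂ : 0 ≤ R₂) (hsupp : ∀ r, R₂ < r → φ r = 0) :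
    positiveRange φ ≤ R₂ :=
  Real.sSup_le (fun _ h => le_of_pos_of_forall_eq_zero hsupp h.2) hR₂

theorem le_positiveRange {φ : ℝ → ℝ} {R₂ : ℝ} (hsupp : ∀ r, R₂ < r → φ r = 0) {r : ℝ}
    (hr : 0 ≤ r) (h : 0 < φ r) : r ≤ positiveRange φ :=
  le_csSup ⟨R₂, fun _ h => le_of_pos_of_forall_eq_zero hsupp h.2⟩ ⟨hr, h⟩

/-- The integral of `φ⁺` over the shell between the radii `R - ε` and `positiveRange φ`. -/
noncomputable def shellIntegral (d : ℕ) (φ : ℝ → ℝ) (R ε : ℝ) : ℝ :=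
  ∫ x in Metric.closedBall (0 : Space d) (positiveRange φ) \ Metric.ball (0 : Space d) (R - ε),
    max (φ ‖x‖) 0

/-- The positive part of the ratio of the volume of the shell between the radii `R` and `R' + ε` to
that of the shell between `ε` and `R`. -/
noncomputable def shellRatio (d : ℕ) (R R' ε : ℝ) : ℝ :=
  max 0 (((R' + ε) ^ d - R ^ d) / (R ^ d - ε ^ d))

theorem shellIntegral_nonneg (d : ℕ) (φ : ℝ → ℝ) (R ε : ℝ) : 0 ≤ shellIntegral d φ R ε :=
  integral_nonneg fun _ => le_max_right _ _

open Filter Topology in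
theorem tendsto_shellIntegral {d : ℕ} (hd : 1 ≤ d) {φ : ℝ → ℝ} (R : ℝ)
    (hφ : Integrable fun x : Space d => max (φ ‖x‖) 0) :
    Tendsto (fun n : ℕ => shellIntegral d φ R (1 / ((n : ℝ) + 1))) atTop
      (𝓝 (∫ x in Metric.closedBall (0 : Space d) (positiveRange φ) \
        Metric.closedBall (0 : Space d) R, max (φ ‖x‖) 0)) := by
  have : Nonempty (Fin d) := ⟨⟨0, hd⟩⟩
  have hnt : Nontrivial (Space d) := inferInstance
  have hlim := tendsto_setIntegral_of_antitone (μ := (volume : Measure (Space d)))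
    (f := fun x : Space d => max (φ ‖x‖) 0)
    (s := fun n : ℕ => Metric.closedBall (0 : Space d) (positiveRange φ) \
      Metric.ball (0 : Space d) (R - 1 / ((n : ℝ) + 1)))
    (fun n => Metric.isClosed_closedBall.measurableSet.diff Metric.isOpen_ball.measurableSet)
    (fun n m hnm => Set.sdiff_subset_sdiff_right (Metric.ball_subset_ball
      (by have := Nat.one_div_le_one_div (α := ℝ) hnm; linarith)))
    ⟨0, hφ.integrableOn⟩
  have hset : (⋂ n : ℕ, Metric.closedBall (0 : Space d) (positiveRange φ) \
      Metric.ball (0 : Space d) (R - 1 / ((n : ℝ) + 1))) =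
      Metric.closedBall (0 : Space d) (positiveRange φ) \ Metric.ball (0 : Space d) R := by
    ext x
    simp only [Set.mem_iInter, Set.mem_sdiff, mem_ball_zero_iff, not_lt]
    constructor
    · intro h
      refine ⟨(h 0).1, ?_⟩
      refine le_of_tendsto' (f := fun n : ℕ => R - 1 / ((n : ℝ) + 1)) (x := atTop) ?_
        fun n => (h n).2
      simpa using tendsto_const_nhds.sub (tendsto_one_div_add_atTop_nhds_zero_nat (𝕜 := ℝ))
    · rintro ⟨h1, h2⟩ n
      have : (0 : ℝ) < 1 / ((n : ℝ) + 1) := by positivity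
      exact ⟨h1, by linarith⟩
  rw [hset] at hlim
  have hsphere : (Metric.ball (0 : Space d) R) =ᵐ[volume] Metric.closedBall 0 R := by
    rw [← Metric.ball_union_sphere]
    exact (union_ae_eq_left_of_ae_eq_empty
      (ae_eq_empty.2 (Measure.addHaar_sphere volume _ _))).symm
  have hae : (Metric.closedBall (0 : Space d) (positiveRange φ) \ Metric.ball (0 : Space d) R :
      Set (Space d)) =ᵐ[volume] (Metric.closedBall (0 : Space d) (positiveRange φ) \
        Metric.closedBall (0 : Space d) R : Set (Space d)) :=
    (EventuallyEq.refl _ _).diff hsphere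
  rw [setIntegral_congr_set hae] at hlim
  exact hlim

open Filter Topology in
theorem tendsto_shellRatio {d : ℕ} (hd : 1 ≤ d) {R : ℝ} (hR : 0 < R) (R' : ℝ) :
    Tendsto (fun n : ℕ => shellRatio d R R' (1 / ((n : ℝ) + 1))) atTop
      (𝓝 (max 0 ((R' / R) ^ d - 1))) := by
  have h0 : Tendsto (fun n : ℕ => 1 / ((n : ℝ) + 1)) atTop (𝓝 0) :=
    tendsto_one_div_add_atTop_nhds_zero_nat
  have hRd : R ^ d ≠ 0 := (pow_pos hR d).ne'
  have hz : (0 : ℝ) ^ d = 0 := zero_pow (by omega)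
  have h1 : (R' / R) ^ d - 1 = ((R' + 0) ^ d - R ^ d) / (R ^ d - 0 ^ d) := by
    rw [hz, add_zero, sub_zero, sub_div, div_self hRd, div_pow]
  rw [h1]
  refine tendsto_const_nhds.max (Tendsto.div ?_ ?_ (by rwa [hz, sub_zero]))
  · exact ((tendsto_const_nhds.add h0).pow d).sub tendsto_const_nhds
  · exact tendsto_const_nhds.sub (h0.pow d)

/-- The integral condition is stable: it survives a small thickening `ε` of the shells. -/
theorem IntegralCondition.exists_thickening {d : ℕ} (hd : 1 ≤ d) {φ : ℝ → ℝ} {R : ℝ} (hR : 0 < R)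
    (hφ : Integrable fun x : Space d => max (φ ‖x‖) 0) (hcond : IntegralCondition d φ R) :
    ∃ ε, 0 < ε ∧ ε < R ∧
      shellRatio d R (positiveRange φ) ε * shellIntegral d φ R ε +
        (∫ x : Space d, max (-φ ‖x‖) 0) <
      sectorConst d * ∫ x in Metric.closedBall (0 : Space d) R, max (φ ‖x‖) 0 := by
  have hlim := ((tendsto_shellRatio hd hR (positiveRange φ)).mul
    (tendsto_shellIntegral hd R hφ)).add_const (∫ x : Space d, max (-φ ‖x‖) 0)
  -- the truncation at `0` is harmless, as the shell is empty when the ratio is negative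
  have hmax : max 0 ((positiveRange φ / R) ^ d - 1) *
      (∫ x in Metric.closedBall (0 : Space d) (positiveRange φ) \
        Metric.closedBall (0 : Space d) R, max (φ ‖x‖) 0) =
      ((positiveRange φ / R) ^ d - 1) *
        (∫ x in Metric.closedBall (0 : Space d) (positiveRange φ) \
          Metric.closedBall (0 : Space d) R, max (φ ‖x‖) 0) := by
    rcases le_total R (positiveRange φ) with h | h
    · rw [max_eq_right]
      exact sub_nonneg.2 (one_le_pow₀ ((one_le_div hR).2 h))
    · rw [Set.sdiff_eq_empty.2 (Metric.closedBall_subset_closedBall h)]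
      simp
  rw [hmax] at hlim
  have hev := (hlim.eventually_lt_const hcond).and
    ((tendsto_one_div_add_atTop_nhds_zero_nat (𝕜 := ℝ)).eventually_lt_const hR)
  obtain ⟨n, h1, h2⟩ := hev.exists
  exact ⟨1 / ((n : ℝ) + 1), by positivity, h2, h1⟩


/-! ### The energy of a contour -/

theorem measurableSet_biUnion_closedBall {d : ℕ} {ω : Set (Space d)} (hω : ω.Countable) (ρ : ℝ) :
    MeasurableSet (⋃ p ∈ ω, Metric.closedBall p ρ) :=
  MeasurableSet.biUnion hω fun _ _ => Metric.isClosed_closedBall.measurableSet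

theorem IsConfiguration.measurableSet_halo {d : ℕ} {ω : Set (Space d)} (hω : IsConfiguration ω)
    (R : ℝ) : MeasurableSet (halo R ω) :=
  measurableSet_biUnion_closedBall hω.countable R

theorem mem_halo_iff {d : ℕ} {R : ℝ} {ω : Set (Space d)} {x : Space d} :
    x ∈ halo R ω ↔ ∃ p ∈ ω, dist x p ≤ R := by
  simp [halo]

/-- A pair interaction between a set of finite volume and an arbitrary set is integrable. -/
theorem integrable_pair {d : ℕ} {ψ : ℝ → ℝ} (hψ : Integrable fun x : Space d => ψ ‖x‖)
    {S : Set (Space d)} (hS : MeasurableSet S) (hSf : volume S ≠ ⊤) (T : Set (Space d)) :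
    Integrable (fun p : Space d × Space d => ψ ‖p.1 - p.2‖)
      ((volume.restrict S).prod (volume.restrict T)) := by
  have h1 : Integrable (S.indicator fun _ : Space d => (1 : ℝ)) :=
    (integrable_indicator_iff hS).2 (integrableOn_const hSf)
  have h2 := (h1.convolution_integrand (ContinuousLinearMap.mul ℝ ℝ) hψ).swap
  have h3 : (fun p : Space d × Space d => ψ ‖p.1 - p.2‖) =ᵐ[(volume.restrict S).prod
      (volume.restrict T)] (fun p : Space d × Space d =>
        S.indicator (fun _ : Space d => (1 : ℝ)) p.1 * ψ ‖p.2 - p.1‖) := by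
    have : ∀ᵐ p : Space d × Space d ∂((volume.restrict S).prod (volume.restrict T)), p.1 ∈ S :=
      Measure.quasiMeasurePreserving_fst.ae (ae_restrict_mem hS)
    filter_upwards [this] with p hp
    rw [Set.indicator_of_mem hp, one_mul, norm_sub_rev]
  refine Integrable.congr ?_ h3.symm
  rw [Measure.prod_restrict]
  exact Integrable.integrableOn h2

theorem integrableOn_integral_pair {d : ℕ} {ψ : ℝ → ℝ} (hψ : Integrable fun x : Space d => ψ ‖x‖)
    {S : Set (Space d)} (hS : MeasurableSet S) (hSf : volume S ≠ ⊤) (T : Set (Space d)) :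
    IntegrableOn (fun x => ∫ y in T, ψ ‖x - y‖) S :=
  (integrable_pair hψ hS hSf T).integral_prod_left

theorem integrable_fun_norm_sub {d : ℕ} {ψ : ℝ → ℝ} (hψ : Integrable fun x : Space d => ψ ‖x‖)
    (x : Space d) : Integrable fun y => ψ ‖x - y‖ :=
  hψ.comp_sub_left x

/-- The sites of `Λ` with a given spin. -/
noncomputable def sitesWithSpin {d : ℕ} (δ : ℝ) (ω : Set (Space d)) (Λ : Finset (Site d))
    (s : Fin 2) : Finset (Site d) :=
  Λ.filter fun i => spin δ ω i = s

theorem mem_sitesWithSpin {d : ℕ} {δ : ℝ} {ω : Set (Space d)} {Λ : Finset (Site d)} {s : Fin 2}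
    {i : Site d} : i ∈ sitesWithSpin δ ω Λ s ↔ i ∈ Λ ∧ spin δ ω i = s :=
  Finset.mem_filter

/-- The part of the halo of `ω` in the empty tiles of `Λ`. -/
def emptyHalo {d : ℕ} (R δ : ℝ) (ω : Set (Space d)) (Λ : Finset (Site d)) : Set (Space d) :=
  ⋃ i ∈ sitesWithSpin δ ω Λ 0, halo R ω ∩ tile δ i

/-- The union of the occupied tiles of `Λ`. -/
def occupiedTiles {d : ℕ} (δ : ℝ) (ω : Set (Space d)) (Λ : Finset (Site d)) : Set (Space d) :=
  ⋃ i ∈ sitesWithSpin δ ω Λ 1, tile δ i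

/-- The points outside the halo of `ω` that have distance at most `ρ` to a point of `ω` in a tile
of `Λ`. -/
noncomputable def collar {d : ℕ} (R ρ δ : ℝ) (ω : Set (Space d)) (Λ : Finset (Site d)) :
    Set (Space d) :=
  (⋃ p ∈ {p ∈ ω | siteOf δ p ∈ Λ}, Metric.closedBall p ρ) \ halo R ω

theorem mem_collar_iff {d : ℕ} {R ρ δ : ℝ} {ω : Set (Space d)} {Λ : Finset (Site d)}
    {y : Space d} : y ∈ collar R ρ δ ω Λ ↔
      (∃ p ∈ ω, siteOf δ p ∈ Λ ∧ dist y p ≤ ρ) ∧ y ∉ halo R ω := by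
  simp only [collar, Set.mem_sdiff, Set.mem_iUnion, Set.mem_ofPred_eq, Metric.mem_closedBall,
    exists_prop, and_assoc]

theorem measurableSet_emptyHalo {d : ℕ} (R δ : ℝ) {ω : Set (Space d)} (hω : IsConfiguration ω)
    (Λ : Finset (Site d)) : MeasurableSet (emptyHalo R δ ω Λ) :=
  Finset.measurableSet_biUnion _ fun i _ => (hω.measurableSet_halo R).inter (measurableSet_tile δ i)

theorem measurableSet_occupiedTiles {d : ℕ} (δ : ℝ) (ω : Set (Space d)) (Λ : Finset (Site d)) :
    MeasurableSet (occupiedTiles δ ω Λ) :=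
  Finset.measurableSet_biUnion _ fun i _ => measurableSet_tile δ i

theorem measurableSet_collar {d : ℕ} (R ρ δ : ℝ) {ω : Set (Space d)} (hω : IsConfiguration ω)
    (Λ : Finset (Site d)) : MeasurableSet (collar R ρ δ ω Λ) :=
  (measurableSet_biUnion_closedBall (hω.countable.mono (Set.sep_subset _ _)) ρ).diff
    (hω.measurableSet_halo R)

theorem volume_tile_ne_top {d : ℕ} {δ : ℝ} (hδ : 0 < δ) (i : Site d) : volume (tile δ i) ≠ ⊤ := by
  rw [volume_tile hδ]; exact ENNReal.ofReal_ne_top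

theorem volume_emptyHalo_ne_top {d : ℕ} {R δ : ℝ} (hδ : 0 < δ) (ω : Set (Space d))
    (Λ : Finset (Site d)) : volume (emptyHalo R δ ω Λ) ≠ ⊤ :=
  (measure_biUnion_lt_top (Finset.finite_toSet _) fun i _ =>
    (measure_mono Set.inter_subset_right).trans_lt (volume_tile_ne_top hδ i).lt_top).ne

theorem volume_occupiedTiles_ne_top {d : ℕ} {δ : ℝ} (hδ : 0 < δ) (ω : Set (Space d))
    (Λ : Finset (Site d)) : volume (occupiedTiles δ ω Λ) ≠ ⊤ :=
  (measure_biUnion_lt_top (Finset.finite_toSet _) fun i _ => (volume_tile_ne_top hδ i).lt_top).ne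

theorem spin_siteOf_of_mem {d : ℕ} {δ : ℝ} (hδ : 0 < δ) {ω : Set (Space d)} {p : Space d}
    (hp : p ∈ ω) : spin δ ω (siteOf δ p) = 1 :=
  spin_eq_one_iff.2 ⟨p, hp, mem_tile_siteOf hδ p⟩

/-- A point outside the halo lies in an empty tile, provided that the diameter of the tiles is at
most `R`. -/
theorem spin_siteOf_eq_zero {d : ℕ} {R δ : ℝ} (hδ : 0 < δ) (hR : √(d : ℝ) * δ ≤ R)
    {ω : Set (Space d)} {y : Space d} (hy : y ∉ halo R ω) : spin δ ω (siteOf δ y) = 0 := by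
  rw [spin_eq_zero_iff]
  by_contra h
  obtain ⟨q, hq, hqt⟩ := Set.nonempty_iff_ne_empty.2 h
  exact hy (mem_halo_iff.2 ⟨q, hq, (dist_le_of_mem_tile hδ (mem_tile_siteOf hδ y) hqt).trans hR⟩)

/-- In the nearest-point cells of `ω` the collar of a contour is compared with the part of the halo
in the empty tiles of the contour. -/
theorem volume_collar_le {d : ℕ} (hd : 1 ≤ d) {R R' ε δ L : ℝ} (hδ : 0 < δ) (hε : 0 < ε)
    (hεR : ε < R) (hδε : 2 * (√(d : ℝ) * δ) ≤ ε) (hL : R' + 2 * (√(d : ℝ) * δ) ≤ 2 * L)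
    {ω : Set (Space d)} (hω : IsConfiguration ω) {Λ : Finset (Site d)}
    (hΛ : IsComponentOf (Λ : Set (Site d)) (nonCorrect δ L ω)) :
    volume.real (collar R (R' + √(d : ℝ) * δ) δ ω Λ) ≤
        shellRatio d R R' ε * volume.real (emptyHalo R δ ω Λ) ∧
      volume (collar R (R' + √(d : ℝ) * δ) δ ω Λ) ≠ ⊤ := by
  have hdδ : 0 < √(d : ℝ) * δ := mul_pos (Real.sqrt_pos.2 (by exact_mod_cast hd)) hδ
  set A := collar R (R' + √(d : ℝ) * δ) δ ω Λ with hA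
  set B := emptyHalo R δ ω Λ with hB
  have hdist : ∀ y ∈ A, ∀ p ∈ ω, (∀ q ∈ ω, dist y p ≤ dist y q) →
      dist y p ≤ R' + √(d : ℝ) * δ := fun y hy p _ hmin => by
    obtain ⟨⟨p₀, hp₀, -, h⟩, -⟩ := mem_collar_iff.1 hy
    exact (hmin p₀ hp₀).trans h
  have key := shell_mul_volume_le hd hω (A := A) (B := B)
    (measurableSet_collar R _ δ hω Λ) (measurableSet_emptyHalo R δ hω Λ) hε hεR.le (R' := R' + ε)
    (fun y hy p hp hmin => by
      refine ⟨?_, by linarith [hdist y hy p hp hmin]⟩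
      by_contra h
      exact (mem_collar_iff.1 hy).2 (mem_halo_iff.2 ⟨p, hp, (not_le.1 h).le⟩))
    (fun ⟨y, hy⟩ => by
      obtain ⟨⟨p₀, hp₀, -⟩, -⟩ := mem_collar_iff.1 hy
      exact ⟨p₀, hp₀⟩)
    (fun y hy p hp hmin t ht0 ht1 h1 h2 hlt => by
      set z := p + t • (y - p) with hz
      have hzp : dist z p = ‖t • (y - p)‖ := by rw [dist_eq_norm, hz, add_sub_cancel_left]
      obtain ⟨⟨p₀, hp₀, hp₀Λ, hyp₀⟩, hyH⟩ := mem_collar_iff.1 hy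
      have hsy := spin_siteOf_eq_zero hδ (by linarith) hyH
      -- the tile of `y` belongs to the contour, as it is empty and near an occupied one
      have hyΛ : siteOf δ y ∈ (Λ : Set (Site d)) := by
        refine mem_component_of_between hδ.le hΛ (i := siteOf δ p₀) (j := siteOf δ y) hp₀Λ ?_ ?_
          (Site.Between.right _ _)
        · rw [hsy, spin_siteOf_of_mem hδ hp₀]; decide
        · have := mul_norm_siteOf_sub_le hδ p₀ y
          rw [dist_comm] at this
          linarith
      have hzΛ : siteOf δ z ∈ (Λ : Set (Site d)) := by
        refine mem_component_of_between hδ.le hΛ (i := siteOf δ y) (j := siteOf δ p) hyΛ ?_ ?_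
          (siteOf_between hδ p y ht0.le ht1.le).symm
        · rw [hsy, spin_siteOf_of_mem hδ hp]; decide
        · have := mul_norm_siteOf_sub_le hδ y p
          linarith [hdist y hy p hp hmin]
      -- the tile of `z` is empty, as even the nearest point `p` is at distance at least `ε`
      have hz0 : spin δ ω (siteOf δ z) = 0 := by
        rw [spin_eq_zero_iff]
        by_contra h
        obtain ⟨q, hq, hqt⟩ := Set.nonempty_iff_ne_empty.2 h
        have h3 := dist_le_of_mem_tile hδ (mem_tile_siteOf hδ z) hqt
        by_cases hqp : q = p
        · rw [hqp] at h3
          linarith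
        · linarith [hlt q hq hqp]
      refine Set.mem_biUnion (mem_sitesWithSpin.2 ⟨hzΛ, hz0⟩) ⟨?_, mem_tile_siteOf hδ z⟩
      exact mem_halo_iff.2 ⟨p, hp, by linarith⟩)
  have hpos : 0 < R ^ d - ε ^ d := sub_pos.2 (pow_lt_pow_left₀ hεR hε.le (by omega))
  have hBf : volume B ≠ ⊤ := volume_emptyHalo_ne_top hδ ω Λ
  have hAf : volume A ≠ ⊤ := by
    intro h
    rw [h, ENNReal.mul_top (ENNReal.ofReal_pos.2 hpos).ne', top_le_iff] at key
    exact ENNReal.mul_ne_top ENNReal.ofReal_ne_top hBf key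
  refine ⟨?_, hAf⟩
  have h1 := ENNReal.toReal_mono (ENNReal.mul_ne_top ENNReal.ofReal_ne_top hBf) key
  rw [ENNReal.toReal_mul, ENNReal.toReal_mul, ENNReal.toReal_ofReal hpos.le,
    ENNReal.toReal_ofReal'] at h1
  change (R ^ d - ε ^ d) * volume.real A ≤ max _ 0 * volume.real B at h1
  have h2 : shellRatio d R R' ε = max ((R' + ε) ^ d - R ^ d) 0 / (R ^ d - ε ^ d) := by
    rw [shellRatio, max_comm, ← max_div_div_right hpos.le, zero_div]
  rw [h2, div_mul_eq_mul_div, le_div_iff₀ hpos, mul_comm (volume.real A)]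
  exact h1

/-- The energy density at a point `x` of the halo: `x` lies in a ball of radius `R` of the halo, over
which `φ⁺` is integrated, and the rest of the halo contributes at worst all of `-φ⁻`. -/
theorem le_integral_halo {d : ℕ} (hd : 2 ≤ d) {φ : ℝ → ℝ} {R : ℝ}
    (hφ : Integrable fun x : Space d => φ ‖x‖) {ω : Set (Space d)} {x : Space d}
    (hx : x ∈ halo R ω) :
    sectorConst d * (∫ y in Metric.closedBall (0 : Space d) R, max (φ ‖y‖) 0) -
        (∫ y : Space d, max (-φ ‖y‖) 0) ≤ ∫ y in halo R ω, φ ‖x - y‖ := by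
  obtain ⟨p, hp, hxp⟩ := mem_halo_iff.1 hx
  have hpos : Integrable fun y : Space d => max (φ ‖y‖) 0 := hφ.pos_part
  have hneg : Integrable fun y : Space d => max (-φ ‖y‖) 0 := hφ.neg_part
  have hposx : Integrable fun y : Space d => max (φ ‖x - y‖) 0 :=
    integrable_fun_norm_sub (ψ := fun r => max (φ r) 0) hpos x
  have hnegx : Integrable fun y : Space d => max (-φ ‖x - y‖) 0 :=
    integrable_fun_norm_sub (ψ := fun r => max (-φ r) 0) hneg x
  have h1 : ∫ y in halo R ω, φ ‖x - y‖ =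
      (∫ y in halo R ω, max (φ ‖x - y‖) 0) - ∫ y in halo R ω, max (-φ ‖x - y‖) 0 := by
    rw [← integral_sub hposx.integrableOn hnegx.integrableOn]
    refine integral_congr_ae (Filter.Eventually.of_forall fun y => ?_)
    exact (max_zero_sub_max_neg_zero_eq_self _).symm
  have h2 : ∫ y in halo R ω, max (-φ ‖x - y‖) 0 ≤ ∫ y : Space d, max (-φ ‖y‖) 0 := by
    rw [← integral_sub_left_eq_self (fun y : Space d => max (-φ ‖y‖) 0) volume x]
    exact setIntegral_le_integral hnegx (Filter.Eventually.of_forall fun y => le_max_right _ _)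
  have h3 : ∫ y in Metric.closedBall p R, max (φ ‖x - y‖) 0 ≤
      ∫ y in halo R ω, max (φ ‖x - y‖) 0 :=
    setIntegral_mono_set hposx.integrableOn (Filter.Eventually.of_forall fun y => le_max_right _ _)
      (Set.subset_biUnion_of_mem (u := fun p => Metric.closedBall p R) hp).eventuallyLE
  have h4 : ∫ y in Metric.closedBall p R, max (φ ‖x - y‖) 0 =
      ∫ y in Metric.closedBall (x - p) R, max (φ ‖y‖) 0 := by
    rw [← (Measure.measurePreserving_sub_left volume x).setIntegral_preimage_emb
      (MeasurableEquiv.subLeft x).measurableEmbedding (fun y : Space d => max (φ ‖y‖) 0)]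
    congr 2
    ext y
    simp [Metric.mem_closedBall, dist_eq_norm, norm_sub_rev]
  have h5 := sectorConst_mul_integral_le hd (f := fun r => max (φ r) 0)
    (fun r => le_max_right _ _) hpos (v := x - p) (R := R) (by rwa [← dist_eq_norm])
  linarith

/-- A tile in the halo has its saturated energy, except for the missing interaction with the
complement of the halo. -/
theorem le_tileEnergy_of_subset_halo {d : ℕ} {φ : ℝ → ℝ} {R δ : ℝ} (hδ : 0 < δ)
    (hφ : Integrable fun x : Space d => φ ‖x‖) {ω : Set (Space d)} (hω : IsConfiguration ω)
    {i : Site d} (hi : tile δ i ⊆ halo R ω) :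
    δ ^ d * potentialIntegral d φ -
        (∫ x in tile δ i, ∫ y in (halo R ω)ᶜ, max (φ ‖x - y‖) 0) ≤ tileEnergy φ R δ ω i := by
  have hpos : Integrable fun y : Space d => max (φ ‖y‖) 0 := hφ.pos_part
  have hf := volume_tile_ne_top (d := d) hδ i
  have hm := measurableSet_tile δ i
  rw [tileEnergy, Set.inter_eq_right.2 hi]
  have h1 : ∫ _x in tile δ i, potentialIntegral d φ = δ ^ d * potentialIntegral d φ := by
    rw [setIntegral_const, smul_eq_mul, measureReal_def, volume_tile hδ,
      ENNReal.toReal_ofReal (by positivity)]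
  have hI := integrableOn_integral_pair (ψ := fun r => max (φ r) 0) hpos hm hf (halo R ω)ᶜ
  have hconst : IntegrableOn (fun _ : Space d => potentialIntegral d φ) (tile δ i) :=
    integrableOn_const hf
  rw [← h1, ← integral_sub hconst hI]
  refine setIntegral_mono (hconst.sub hI)
    (integrableOn_integral_pair hφ hm hf _) fun x => ?_
  have hφx := integrable_fun_norm_sub hφ x
  have h2 := integral_add_compl (hω.measurableSet_halo R) hφx
  have h3 : ∫ y, φ ‖x - y‖ = potentialIntegral d φ :=
    integral_sub_left_eq_self (fun y : Space d => φ ‖y‖) volume x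
  have h4 : ∫ y in (halo R ω)ᶜ, φ ‖x - y‖ ≤ ∫ y in (halo R ω)ᶜ, max (φ ‖x - y‖) 0 :=
    setIntegral_mono hφx.integrableOn
      (integrable_fun_norm_sub (ψ := fun r => max (φ r) 0) hpos x).integrableOn
      fun y => le_max_left _ _
  simp only
  linarith

theorem tile_subset_halo_of_spin_eq_one {d : ℕ} {R δ : ℝ} (hδ : 0 < δ) (hR : √(d : ℝ) * δ ≤ R)
    {ω : Set (Space d)} {i : Site d} (hi : spin δ ω i = 1) : tile δ i ⊆ halo R ω := fun x hx => by
  obtain ⟨p, hp, hpt⟩ := spin_eq_one_iff.1 hi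
  exact mem_halo_iff.2 ⟨p, hp, (dist_le_of_mem_tile hδ hx hpt).trans hR⟩

/-- The lower bound on the energy that results from treating empty and occupied tiles separately. -/
theorem le_energy_sub_saturatedEnergy {d : ℕ} (hd : 2 ≤ d) {φ : ℝ → ℝ} {R δ : ℝ} (hδ : 0 < δ)
    (hR : √(d : ℝ) * δ ≤ R) (hφ : Integrable fun x : Space d => φ ‖x‖) {ω : Set (Space d)}
    (hω : IsConfiguration ω) (Λ : Finset (Site d)) :
    (sectorConst d * (∫ y in Metric.closedBall (0 : Space d) R, max (φ ‖y‖) 0) -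
        (∫ y : Space d, max (-φ ‖y‖) 0)) * volume.real (emptyHalo R δ ω Λ) -
      (∫ x in occupiedTiles δ ω Λ, ∫ y in (halo R ω)ᶜ, max (φ ‖x - y‖) 0) ≤
    energy φ R δ Λ ω - saturatedEnergy φ δ Λ ω := by
  set c := sectorConst d * (∫ y in Metric.closedBall (0 : Space d) R, max (φ ‖y‖) 0) -
        (∫ y : Space d, max (-φ ‖y‖) 0)
  have hpos : Integrable fun y : Space d => max (φ ‖y‖) 0 := hφ.pos_part
  have hvol : volume.real (emptyHalo R δ ω Λ) =
      ∑ i ∈ sitesWithSpin δ ω Λ 0, volume.real (halo R ω ∩ tile δ i) :=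
    measureReal_biUnion_finset
      (fun i _ j _ hij => (disjoint_tile hδ hij).mono Set.inter_subset_right Set.inter_subset_right)
      (fun i _ => (hω.measurableSet_halo R).inter (measurableSet_tile δ i))
      (fun i _ => measure_ne_top_of_subset Set.inter_subset_right (volume_tile_ne_top hδ i))
  have hint : ∫ x in occupiedTiles δ ω Λ, ∫ y in (halo R ω)ᶜ, max (φ ‖x - y‖) 0 =
      ∑ i ∈ sitesWithSpin δ ω Λ 1, ∫ x in tile δ i, ∫ y in (halo R ω)ᶜ, max (φ ‖x - y‖) 0 :=
    integral_biUnion_finset _ (fun i _ => measurableSet_tile δ i)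
      (fun i _ j _ hij => disjoint_tile hδ hij)
      (fun i _ => integrableOn_integral_pair (ψ := fun r => max (φ r) 0) hpos
        (measurableSet_tile δ i) (volume_tile_ne_top hδ i) _)
  have hsplit : ∀ f : Site d → ℝ, ∑ i ∈ Λ, f i =
      ∑ i ∈ sitesWithSpin δ ω Λ 0, f i + ∑ i ∈ sitesWithSpin δ ω Λ 1, f i := by
    intro f
    rw [← Finset.sum_filter_add_sum_filter_not Λ (fun i => spin δ ω i = 0)]
    congr 2
    ext i
    have : ∀ s : Fin 2, ¬ s = 0 ↔ s = 1 := by decide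
    simp only [sitesWithSpin, Finset.mem_filter, this]
  rw [hvol, hint, energy, saturatedEnergy, ← Finset.sum_sub_distrib, hsplit, Finset.mul_sum,
    sub_eq_add_neg, ← Finset.sum_neg_distrib]
  refine add_le_add (Finset.sum_le_sum fun i hi => ?_) (Finset.sum_le_sum fun i hi => ?_)
  · have h0 := spin_eq_zero_iff.1 (mem_sitesWithSpin.1 hi).2
    rw [saturatedTileEnergy, if_neg (Set.not_nonempty_iff_eq_empty.2 h0), sub_zero, tileEnergy]
    have hf := measure_ne_top_of_subset (Set.inter_subset_right (s := halo R ω))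
      (volume_tile_ne_top hδ i)
    have hm := (hω.measurableSet_halo R).inter (measurableSet_tile δ i)
    exact setIntegral_ge_of_const_le_real hm hf (fun x hx => le_integral_halo hd hφ hx.1)
      (integrableOn_integral_pair hφ hm hf _)
  · have h1 := (mem_sitesWithSpin.1 hi).2
    rw [saturatedTileEnergy, if_pos (spin_eq_one_iff.1 h1)]
    have := le_tileEnergy_of_subset_halo hδ hφ hω (tile_subset_halo_of_spin_eq_one hδ hR h1)
    linarith

/-- The interaction of the occupied tiles with the complement of the halo is concentrated on the
collar, where it is bounded by the integral over a shell. -/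
theorem integral_occupiedTiles_le {d : ℕ} {φ : ℝ → ℝ} {R R₂ ε δ : ℝ} (hδ : 0 < δ)
    (hsupp : ∀ r : ℝ, R₂ < r → φ r = 0) (hδε : √(d : ℝ) * δ ≤ ε)
    (hφ : Integrable fun x : Space d => max (φ ‖x‖) 0) {ω : Set (Space d)}
    (hω : IsConfiguration ω) (Λ : Finset (Site d))
    (hfin : volume (collar R (positiveRange φ + √(d : ℝ) * δ) δ ω Λ) ≠ ⊤) :
    ∫ x in occupiedTiles δ ω Λ, ∫ y in (halo R ω)ᶜ, max (φ ‖x - y‖) 0 ≤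
      shellIntegral d φ R ε *
        volume.real (collar R (positiveRange φ + √(d : ℝ) * δ) δ ω Λ) := by
  set O := occupiedTiles δ ω Λ
  set A := collar R (positiveRange φ + √(d : ℝ) * δ) δ ω Λ with hA
  have hOm : MeasurableSet O := measurableSet_occupiedTiles δ ω Λ
  have hAm : MeasurableSet A := measurableSet_collar R _ δ hω Λ
  have hHm := (hω.measurableSet_halo R).compl
  have hpair := integrable_pair (ψ := fun r => max (φ r) 0) hφ hOm
    (volume_occupiedTiles_ne_top hδ ω Λ) (halo R ω)ᶜ
  rw [integral_integral_swap hpair]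
  have hO : ∀ x ∈ O, ∃ p ∈ ω, siteOf δ p ∈ Λ ∧ dist x p ≤ √(d : ℝ) * δ := fun x hx => by
    obtain ⟨i, hi, hxi⟩ := Set.mem_iUnion₂.1 hx
    obtain ⟨hiΛ, hi1⟩ := mem_sitesWithSpin.1 hi
    obtain ⟨p, hp, hpt⟩ := spin_eq_one_iff.1 hi1
    exact ⟨p, hp, (mem_tile_iff hδ).1 hpt ▸ hiΛ, dist_le_of_mem_tile hδ hxi hpt⟩
  have hrange : ∀ x y : Space d, max (φ ‖x - y‖) 0 ≠ 0 → dist x y ≤ positiveRange φ := by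
    intro x y h
    rw [dist_eq_norm]
    refine le_positiveRange hsupp (norm_nonneg _) ?_
    by_contra hcon
    exact h (max_eq_right (not_lt.1 hcon))
  set S : Set (Space d) := Metric.closedBall (0 : Space d) (positiveRange φ) \
    Metric.ball (0 : Space d) (R - ε) with hS
  have hSm : MeasurableSet S :=
    Metric.isClosed_closedBall.measurableSet.diff Metric.isOpen_ball.measurableSet
  have hbound : ∀ y ∈ (halo R ω)ᶜ, ∫ x in O, max (φ ‖x - y‖) 0 ≤
      A.indicator (fun _ => shellIntegral d φ R ε) y := by
    intro y hy
    by_cases hyA : y ∈ A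
    · rw [Set.indicator_of_mem hyA]
      have h1 : ∀ x ∈ O, max (φ ‖x - y‖) 0 =
          S.indicator (fun z : Space d => max (φ ‖z‖) 0) (x - y) := by
        intro x hx
        by_cases hxS : x - y ∈ S
        · rw [Set.indicator_of_mem hxS]
        · rw [Set.indicator_of_notMem hxS]
          by_contra hne
          refine hxS ⟨?_, ?_⟩
          · rw [mem_closedBall_zero_iff, ← dist_eq_norm]
            exact hrange x y hne
          · rw [mem_ball_zero_iff, ← dist_eq_norm, not_lt]
            obtain ⟨p, hp, -, hxp⟩ := hO x hx
            have h2 : R < dist y p := by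
              by_contra hcon
              exact hy (mem_halo_iff.2 ⟨p, hp, not_lt.1 hcon⟩)
            have := dist_triangle_left y p x
            linarith
      have hSint : Integrable (S.indicator fun z : Space d => max (φ ‖z‖) 0) := hφ.indicator hSm
      rw [setIntegral_congr_fun hOm h1, shellIntegral, ← integral_indicator hSm,
        ← integral_sub_right_eq_self (S.indicator fun z : Space d => max (φ ‖z‖) 0) y]
      exact setIntegral_le_integral (hSint.comp_sub_right y)
        (Filter.Eventually.of_forall fun x =>
          Set.indicator_nonneg (fun _ _ => le_max_right _ _) _)
    · rw [Set.indicator_of_notMem hyA]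
      refine (setIntegral_eq_zero_of_forall_eq_zero fun x hx => ?_).le
      by_contra hne
      refine hyA (mem_collar_iff.2 ⟨?_, hy⟩)
      obtain ⟨p, hp, hpΛ, hxp⟩ := hO x hx
      refine ⟨p, hp, hpΛ, ?_⟩
      have h1 := hrange x y hne
      have h2 := dist_triangle_left y p x
      linarith
  calc ∫ y in (halo R ω)ᶜ, ∫ x in O, max (φ ‖x - y‖) 0
      ≤ ∫ y in (halo R ω)ᶜ, A.indicator (fun _ => shellIntegral d φ R ε) y := by
        refine setIntegral_mono_on hpair.integral_prod_right ?_ hHm hbound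
        exact ((integrable_indicator_iff hAm).2 (integrableOn_const hfin)).integrableOn
    _ ≤ ∫ y, A.indicator (fun _ => shellIntegral d φ R ε) y :=
        setIntegral_le_integral ((integrable_indicator_iff hAm).2 (integrableOn_const hfin))
          (Filter.Eventually.of_forall fun y =>
            Set.indicator_nonneg (fun _ _ => shellIntegral_nonneg d φ R ε) _)
    _ = _ := by
        rw [integral_indicator_const _ hAm, smul_eq_mul, mul_comm]

/-- The empty tiles of `K`, each of which has an occupied neighbour, lie in the halo. -/
theorem card_mul_le_volume_emptyHalo {d : ℕ} {R δ : ℝ} (hδ : 0 < δ)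
    (hR : 2 * (√(d : ℝ) * δ) ≤ R) {ω : Set (Space d)} {Λ K : Finset (Site d)}
    (hK : ∀ k ∈ K, k ∈ Λ ∧ spin δ ω k = 0 ∧ ∃ k', (siteGraph d).Adj k k' ∧ spin δ ω k' = 1) :
    (K.card : ℝ) * δ ^ d ≤ volume.real (emptyHalo R δ ω Λ) := by
  have hsub : (⋃ k ∈ K, tile δ k) ⊆ emptyHalo R δ ω Λ := by
    refine Set.iUnion₂_subset fun k hk x hx => ?_
    obtain ⟨hkΛ, hk0, k', hadj, hk1⟩ := hK k hk
    obtain ⟨p, hp, hpt⟩ := spin_eq_one_iff.1 hk1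
    exact Set.mem_biUnion (mem_sitesWithSpin.2 ⟨hkΛ, hk0⟩)
      ⟨mem_halo_iff.2 ⟨p, hp, (dist_le_of_mem_tile_of_adj hδ hadj hx hpt).trans hR⟩, hx⟩
  have hvol : volume.real (⋃ k ∈ K, tile δ k) = ∑ k ∈ K, volume.real (tile δ k) :=
    measureReal_biUnion_finset (fun i _ j _ hij => disjoint_tile hδ hij)
      (fun i _ => measurableSet_tile δ i) (fun i _ => volume_tile_ne_top hδ i)
  have htile : ∀ k : Site d, volume.real (tile δ k) = δ ^ d := fun k => by
    rw [measureReal_def, volume_tile hδ, ENNReal.toReal_ofReal (by positivity)]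
  simp only [htile, Finset.sum_const, nsmul_eq_mul] at hvol
  rw [← hvol]
  exact measureReal_mono hsub (volume_emptyHalo_ne_top hδ ω Λ)

theorem mainTheorem4 (d : ℕ) (hd : 2 ≤ d) (φ : ℝ → ℝ) (R R₂ : ℝ) (hR : 0 < R) (hR₂ : 0 < R₂)
    (hint : IntegrableOn (fun r : ℝ => r ^ (d - 1) * φ r) (Set.Ioi 0))
    (hsupp : ∀ r : ℝ, R₂ < r → φ r = 0)
    (hcond : IntegralCondition d φ R) :
    ∃ δ₀ : ℝ, 0 < δ₀ ∧ ∀ δ : ℝ, 0 < δ → δ ≤ δ₀ → ∀ L : ℝ, R₂ + 2 * √(d : ℝ) * δ < L →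
      ∃ e : ℝ, 0 < e ∧ ∀ (γ : Contour d) (ω : Set (Space d)), IsConfiguration ω →
        γ.AchievedBy δ L ω →
          e * (γ.support.card : ℝ) ≤
            energy φ R δ γ.support ω - saturatedEnergy φ δ γ.support ω := by
  classical
  have hd1 : 1 ≤ d := by omega
  have : Nonempty (Fin d) := ⟨⟨0, hd1⟩⟩
  have hnt : Nontrivial (Space d) := inferInstance
  have hφ : Integrable fun x : Space d => φ ‖x‖ := by
    rw [integrable_fun_norm_addHaar volume, finrank_euclideanSpace_fin]
    exact hint
  have hpos : Integrable fun y : Space d => max (φ ‖y‖) 0 := hφ.pos_part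
  obtain ⟨ε, hε, hεR, hlt⟩ := hcond.exists_thickening hd1 hR hpos
  have hsd : 0 < √(d : ℝ) := Real.sqrt_pos.2 (by exact_mod_cast hd1)
  set c₁ := sectorConst d * (∫ y in Metric.closedBall (0 : Space d) R, max (φ ‖y‖) 0) -
    (∫ y : Space d, max (-φ ‖y‖) 0) with hc₁
  set c := c₁ - shellRatio d R (positiveRange φ) ε * shellIntegral d φ R ε with hc
  have hcpos : 0 < c := by rw [hc, hc₁]; linarith
  -- for `δ` below this bound a tile has diameter at most `√d δ ≤ ε / 2`, and points of adjacent
  -- tiles are at distance at most `ε`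
  refine ⟨ε / (2 * √(d : ℝ)), by positivity, fun δ hδ hδ₀ L hL => ?_⟩
  have hδε : 2 * (√(d : ℝ) * δ) ≤ ε := by
    rw [le_div_iff₀ (by positivity)] at hδ₀
    linarith
  have hdδ : 0 < √(d : ℝ) * δ := by positivity
  have hR₁ := positiveRange_le hR₂.le hsupp
  obtain ⟨N, hN, hcard⟩ := exists_card_support_le (d := d) (L := L) hδ (by linarith)
  refine ⟨c * δ ^ d / N, by positivity, fun γ ω hω hγ => ?_⟩
  -- the empty tiles with an occupied neighbour
  set K := γ.support.filter fun k => spin δ ω k = 0 ∧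
    ∃ k', (siteGraph d).Adj k k' ∧ spin δ ω k' = 1 with hK
  have h1 : (γ.support.card : ℝ) ≤ N * K.card := by
    exact_mod_cast hcard γ ω hγ K fun k hk h0 hadj => Finset.mem_filter.2 ⟨hk, h0, hadj⟩
  have h2 := card_mul_le_volume_emptyHalo (R := R) hδ (by linarith) (ω := ω) (Λ := γ.support)
    (K := K) fun k hk => ⟨(Finset.mem_filter.1 hk).1, (Finset.mem_filter.1 hk).2⟩
  obtain ⟨h3, hfin⟩ := volume_collar_le hd1 (R' := positiveRange φ) (L := L) hδ hε hεR hδε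
    (by linarith) hω hγ.1
  have h4 := integral_occupiedTiles_le (R := R) (ε := ε) hδ hsupp (by linarith) hpos hω γ.support
    hfin
  have h5 := le_energy_sub_saturatedEnergy hd (R := R) hδ (by linarith) hφ hω γ.support
  have h6 := mul_le_mul_of_nonneg_left h3 (shellIntegral_nonneg d φ R ε)
  have hN' : (0 : ℝ) < N := by exact_mod_cast hN
  calc c * δ ^ d / N * γ.support.card ≤ c * δ ^ d / N * (N * K.card) := by gcongr
    _ = c * (K.card * δ ^ d) := by field_simp
    _ ≤ c * volume.real (emptyHalo R δ ω γ.support) := by gcongr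
    _ ≤ _ := by
      rw [hc]
      linarith
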